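/- Let $d$ be a fixed integer and $\beta^\star\in\mathbb R^d$. For each $n$ we observe $(X_i,Y_i)$, $1\le i\le n$, with $$Y_i=\mu_i^\star+X_i^T\beta^\star+\epsilon_i ,$$ where the $X_i\in\mathbb R^d$ are i.i.d. and square integrable with mean zero and positive definite covariance matrix $\Sigma_X$, the $\epsilon_i$ are i.i.d. with mean zero and finite variance $\sigma^2$, and the sequences $(X_i)$ and $(\epsilon_i)$ are independent. Here $a_n\ll b_n$ means $a_n/b_n\to0$, $a_n\gg b_n$ means $b_n\ll a_n$, $a_n\sim b_n$ means $a_n/b_n\to1$, and all limits are as $n\to\infty$. Let $\kappa_n,\gamma_n\ll\sqrt n$ be positive sequences with $$P\Big(\max_{1\le i\le n}\|X_i\|_2>\kappa_n\Big)\to0,\qquad P\Big(\max_{1\le i\le n}|\epsilon_i|>\gamma_n\Big)\to0 .$$ The incidental parameters $\mu_i^\star=\mu_{n,i}^\star$ are deterministic and may depend on $n$. With $s_1=s_1(n)\ll n$, $s_2=s_2(n)\ll n$ and $s_1+s_2\le n$, the first $s_1$ of them are large (in the sense of the condition on $\lambda$ below), the next $s_2$ are nonzero with $|\mu_i^\star|\le\gamma_n$,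 and the remaining ones are zero. The regularization parameter $\lambda=\lambda_n$ satisfies $$\kappa_n\ll\lambda,\qquad \alpha\gamma_n\le\lambda\ \text{ for some constant }\alpha>2,\qquad \lambda\ll\min\Big\{\min_{1\le i\le s_1}|\mu_i^\star|,\ \sqrt n\Big\},$$ and $s_2\ll\sqrt n/(\kappa_n\gamma_n)$. Then there is a sequence of ($P$-almost everywhere measurable) estimators $\hat\beta_n$ such that, with probability going to one, $\hat\beta_n$ is the unique $\beta$-component of the minimizers $(\mu,\beta)\in\mathbb R^n\times\mathbb R^d$ of the penalized criterion $$\sum_{i=1}^n (Y_i-\mu_i-X_i^T\beta)^2+\sum_{i=1}^n 2\lambda|\mu_i| ,$$ and is also the unique root $\beta\in\mathbb R^d$ of $$\varphi_n(\beta)=\beta-(\mathbf X^T\mathbf X)^{-1}\mathbf X^T\big(\mathbf Y-\mu(\beta)\big),\qquad \mu_i(\beta)=(|Y_i-X_i^T\beta|-\lambda)_+\,\mathrm{sgn}(Y_i-X_i^T\beta),$$ where $\mathbf X$ has rows $X_i^T$. It is consistent, $\hat\beta_n\to\beta^\star$ in probability, and 1. if $s_1\ll n/\lambda^2$, then $\sqrt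 n(\hat\beta_n-\beta^\star)\xrightarrow{d}N(0,\sigma^2\Sigma_X^{-1})$; 2. for every constant $b>0$, if $s_1\sim bn/\lambda^2$, then $\sqrt n(\hat\beta_n-\beta^\star)\xrightarrow{d}N(0,(b+\sigma^2)\Sigma_X^{-1})$; 3. if $s_1\gg n/\lambda^2$, then $r_n(\hat\beta_n-\beta^\star)\xrightarrow{d}N(0,\Sigma_X^{-1})$ with $r_n=n/(\lambda\sqrt{s_1})$. -/

import Mathlib

open MeasureTheory ProbabilityTheory Filter Asymptotics Topology

noncomputable section

/-- The soft-thresholding function `t ↦ (|t| - l)₊ sgn t`. -/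
def softThreshold (l t : ℝ) : ℝ := max (|t| - l) 0 * Real.sign t

/-- The design matrix, with rows `x₁ᵀ, …, xₙᵀ`. -/
def designMatrix {n d : ℕ} (x : Fin n → EuclideanSpace ℝ (Fin d)) : Matrix (Fin n) (Fin d) ℝ :=
  Matrix.of fun i j => x i j

/-- The penalized least-squares criterion with soft penalty `2 l |μᵢ|` on the incidental
parameters `m`. -/
def penalizedLoss {n d : ℕ} (l : ℝ) (x : Fin n → EuclideanSpace ℝ (Fin d)) (y : Fin n → ℝ)
    (m : Fin n → ℝ) (b : EuclideanSpace ℝ (Fin d)) : ℝ :=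
  ∑ i, (y i - m i - inner ℝ (x i) b) ^ 2 + ∑ i, 2 * l * |m i|

/-- `b` is the `β`-component of a global minimizer `(m, b)` of the penalized criterion. -/
def IsPenalizedEstimate {n d : ℕ} (l : ℝ) (x : Fin n → EuclideanSpace ℝ (Fin d))
    (y : Fin n → ℝ) (b : EuclideanSpace ℝ (Fin d)) : Prop :=
  ∃ m : Fin n → ℝ, ∀ (m' : Fin n → ℝ) (b' : EuclideanSpace ℝ (Fin d)),
    penalizedLoss l x y m b ≤ penalizedLoss l x y m' b'

/-- The estimating function `φₙ(b) = b - (XᵀX)⁻¹ Xᵀ (y - m(b))`, where `m(b)` is the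
componentwise soft-thresholding of the residuals `y - X b`. -/
def estimatingFunction {n d : ℕ} (l : ℝ) (x : Fin n → EuclideanSpace ℝ (Fin d))
    (y : Fin n → ℝ) (b : EuclideanSpace ℝ (Fin d)) : EuclideanSpace ℝ (Fin d) :=
  b - WithLp.toLp 2 ((((designMatrix x).transpose * designMatrix x)⁻¹).mulVec
    ((designMatrix x).transpose.mulVec
      fun i => y i - softThreshold l (y i - inner ℝ (x i) b)))

/-- The covariance matrix of a random vector. -/
def covarianceMatrix {Ω : Type*} [MeasurableSpace Ω] {d : ℕ} (P : Measure Ω)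
    (Z : Ω → EuclideanSpace ℝ (Fin d)) : Matrix (Fin d) (Fin d) ℝ :=
  Matrix.of fun j k => cov[fun ω => Z ω j, fun ω => Z ω k; P]

/-- The events `E n` hold with probability going to one (stated through the outer measure of
the complements, so that no measurability of the events is presupposed). -/
def WithProbGoingToOne {Ω : Type*} [MeasurableSpace Ω] (P : Measure Ω) (E : ℕ → Ω → Prop) :
    Prop :=
  Tendsto (fun n => P {ω | ¬ E n ω}) atTop (𝓝 0)

/-- `Z n` converges in distribution to the centred normal law `N(0, S)`. -/
def ConvergesToNormal {Ω : Type*} [MeasurableSpace Ω] (P : Measure Ω) [IsProbabilityMeasure P]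
    {d : ℕ} (Z : ℕ → Ω → EuclideanSpace ℝ (Fin d)) (S : Matrix (Fin d) (Fin d) ℝ) : Prop :=
  TendstoInDistribution Z atTop (id : EuclideanSpace ℝ (Fin d) → EuclideanSpace ℝ (Fin d))
    (fun _ => P) (multivariateGaussian 0 S)

/-- The first `n` covariate vectors, observed at `ω`. -/
def sampleX {Ω : Type*} {d : ℕ} (X : ℕ → Ω → EuclideanSpace ℝ (Fin d)) (n : ℕ) (ω : Ω) :
    Fin n → EuclideanSpace ℝ (Fin d) :=
  fun i => X i ω

/-- The `n` responses `Yᵢ = μᵢ + Xᵢᵀ β + εᵢ`, observed at `ω`; the incidental parameters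
`μ n i` may depend on the sample size `n`. -/
def sampleY {Ω : Type*} {d : ℕ} (X : ℕ → Ω → EuclideanSpace ℝ (Fin d)) (ε : ℕ → Ω → ℝ)
    (μ : ℕ → ℕ → ℝ) (β : EuclideanSpace ℝ (Fin d)) (n : ℕ) (ω : Ω) : Fin n → ℝ :=
  fun i => μ n i + inner ℝ (X i ω) β + ε i ω

end

/-! Subtracting its soft-threshold from a residual clips it to `[-l, l]`. The score equation says
that the covariates weighted by the clipped residuals sum to zero; when the Gram matrix is
invertible, this is equivalent to `estimatingFunction = 0`. At a root, the penalized criterion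
exceeds its value there by an explicit sum of nonnegative terms (`penalizedLoss_eq_add`), so the
root is a minimizer. It is the only one if the covariates with unclipped residuals span the space.

With probability going to one, every point within distance 1 of `β` clips exactly the large
incidental parameters, with the sign of `μ n i`: noise, bounded parameter and `inner ℝ (x i) (b -
β)` together stay below `lam n`, while the large `μ n i` dominate. The score equation is then linear
on this ball. Its solution `oracleEstimate` is explicit, and if it lies in the ball it is the unique
estimate and root (`unique_of_linear_system`). It is written with `β`, `μ` and `ε`, but on that
event it coincides with the data-based estimate.

The rescaled error is a normalized inverse Gram matrix times a score. The matrix tends to the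
inverse covariance by the strong law, since the first `s₁ n` indices are negligible. The score
splits into a clipped block of `± lam n` multiples of `X i`, a noise block `ε i • X i` on disjoint
indices, and a bias from the bounded parameters, negligible by the condition on `s₂`. A
characteristic-function CLT for the two blocks and Slutsky's theorem give covariance `(A + B σ²)
Σ⁻¹`, where `A` and `B` are the limits of `s₁ (r lam / n)²` and `r² / n`. Consistency and the three
regimes are choices of `r`. -/

lemma sub_softThreshold_of_abs_le {l t : ℝ} (h : |t| ≤ l) : t - softThreshold l t = t := by
  simp [softThreshold, max_eq_right (sub_nonpos.2 h)]

lemma sub_softThreshold_of_le_abs {l t : ℝ} (h : l ≤ |t|) :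
    t - softThreshold l t = l * Real.sign t := by
  rw [softThreshold, max_eq_left (sub_nonneg.2 h), sub_mul]
  have : |t| * Real.sign t = t := by
    rcases lt_trichotomy t 0 with ht | rfl | ht
    · rw [Real.sign_of_neg ht, abs_of_neg ht]; ring
    · simp
    · rw [Real.sign_of_pos ht, abs_of_pos ht]; ring
  rw [this]; ring

lemma abs_sub_softThreshold_le {l : ℝ} (hl : 0 ≤ l) (t : ℝ) : |t - softThreshold l t| ≤ l := by
  rcases le_total |t| l with h | h
  · rwa [sub_softThreshold_of_abs_le h]
  · rw [sub_softThreshold_of_le_abs h, abs_mul, abs_of_nonneg hl]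
    rcases Real.sign_apply_eq t with h | h | h <;> simp [h, hl]

/-- Complementary slackness: where the thresholded value is nonzero, the clipped residual is `l`
times its sign. -/
lemma sub_softThreshold_mul (l t : ℝ) :
    (t - softThreshold l t) * softThreshold l t = l * |softThreshold l t| := by
  rcases le_total |t| l with h | h
  · have : softThreshold l t = 0 := by linarith [sub_softThreshold_of_abs_le h]
    simp [this]
  · rw [sub_softThreshold_of_le_abs h, softThreshold, abs_mul,
      abs_of_nonneg (le_max_right (|t| - l) 0)]
    rcases Real.sign_apply_eq t with h | h | h <;> simp [h]

/-! ### Optimality and uniqueness for fixed data -/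

section Deterministic

variable {n d : ℕ} {l : ℝ} {x : Fin n → EuclideanSpace ℝ (Fin d)} {y : Fin n → ℝ}

/-- The clipped residual `r - soft(r)` of the `i`-th observation at the parameter `b`. -/
noncomputable def clippedResidual (l : ℝ) (x : Fin n → EuclideanSpace ℝ (Fin d)) (y : Fin n → ℝ)
    (b : EuclideanSpace ℝ (Fin d)) (i : Fin n) : ℝ :=
  (y i - inner ℝ (x i) b) - softThreshold l (y i - inner ℝ (x i) b)

/-- Excess of the penalized criterion over its value at a root of the score. -/
lemma penalizedLoss_eq_add {b : EuclideanSpace ℝ (Fin d)}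
    (hb : ∑ i, clippedResidual l x y b i • x i = 0) (m' : Fin n → ℝ)
    (b' : EuclideanSpace ℝ (Fin d)) :
    penalizedLoss l x y m' b' =
      penalizedLoss l x y (fun i => softThreshold l (y i - inner ℝ (x i) b)) b +
      ∑ i, ((y i - m' i - inner ℝ (x i) b' - clippedResidual l x y b i) ^ 2 +
        2 * (l * |m' i| - clippedResidual l x y b i * m' i)) := by
  -- The score equation removes the term linear in `b' - b`; the pointwise identity below otherwise
  -- needs only complementary slackness.
  have h0 : ∑ i, clippedResidual l x y b i * inner ℝ (x i) (b' - b) = 0 := by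
    have := congrArg (fun v => inner ℝ v (b' - b)) hb
    simpa [sum_inner, real_inner_smul_left] using this
  have key : ∀ i, ((y i - m' i - inner ℝ (x i) b') ^ 2 + 2 * l * |m' i|) =
      ((y i - softThreshold l (y i - inner ℝ (x i) b) - inner ℝ (x i) b) ^ 2 +
        2 * l * |softThreshold l (y i - inner ℝ (x i) b)|) +
      ((y i - m' i - inner ℝ (x i) b' - clippedResidual l x y b i) ^ 2 +
        2 * (l * |m' i| - clippedResidual l x y b i * m' i)) -
      2 * (clippedResidual l x y b i * inner ℝ (x i) (b' - b)) := by
    intro i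
    have h1 := sub_softThreshold_mul l (y i - inner ℝ (x i) b)
    rw [inner_sub_right, clippedResidual]
    linear_combination 2 * h1
  simp only [penalizedLoss]
  rw [← Finset.sum_add_distrib, ← Finset.sum_add_distrib, ← Finset.sum_add_distrib,
    Finset.sum_congr rfl fun i _ => key i, Finset.sum_sub_distrib, ← Finset.mul_sum, h0]
  simp

lemma excess_nonneg (hl : 0 ≤ l) (b : EuclideanSpace ℝ (Fin d)) (m' : Fin n → ℝ)
    (i : Fin n) :
    0 ≤ l * |m' i| - clippedResidual l x y b i * m' i := by
  have h := abs_sub_softThreshold_le hl (y i - inner ℝ (x i) b)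
  have : clippedResidual l x y b i * m' i ≤ l * |m' i| :=
    (le_abs_self _).trans (by rw [abs_mul]; exact mul_le_mul_of_nonneg_right h (abs_nonneg _))
  linarith

lemma isPenalizedEstimate_of_sum_eq_zero (hl : 0 ≤ l) {b : EuclideanSpace ℝ (Fin d)}
    (hb : ∑ i, clippedResidual l x y b i • x i = 0) : IsPenalizedEstimate l x y b := by
  refine ⟨fun i => softThreshold l (y i - inner ℝ (x i) b), fun m' b' => ?_⟩
  rw [penalizedLoss_eq_add hb m' b']
  have : 0 ≤ ∑ i, ((y i - m' i - inner ℝ (x i) b' - clippedResidual l x y b i) ^ 2 +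
        2 * (l * |m' i| - clippedResidual l x y b i * m' i)) :=
    Finset.sum_nonneg fun i _ => add_nonneg (sq_nonneg _)
      (mul_nonneg zero_le_two (excess_nonneg hl b m' i))
  linarith

/-- A root of the score whose small residuals belong to covariates spanning the space is the only
penalized estimate. -/
lemma IsPenalizedEstimate.eq_of_sum_eq_zero (hl : 0 ≤ l) {b : EuclideanSpace ℝ (Fin d)}
    (hb : ∑ i, clippedResidual l x y b i • x i = 0)
    (hspan : ∀ v, (∀ i, |y i - inner ℝ (x i) b| < l → inner ℝ (x i) v = 0) → v = 0)
    {b' : EuclideanSpace ℝ (Fin d)} (hb' : IsPenalizedEstimate l x y b') : b' = b := by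
  obtain ⟨m', hm'⟩ := hb'
  have hle := hm' (fun i => softThreshold l (y i - inner ℝ (x i) b)) b
  rw [penalizedLoss_eq_add hb m' b'] at hle
  have hnn : ∀ i ∈ Finset.univ,
      0 ≤ (y i - m' i - inner ℝ (x i) b' - clippedResidual l x y b i) ^ 2 +
        2 * (l * |m' i| - clippedResidual l x y b i * m' i) := fun i _ =>
    add_nonneg (sq_nonneg _) (mul_nonneg zero_le_two (excess_nonneg hl b m' i))
  have hz := (Finset.sum_eq_zero_iff_of_nonneg hnn).1
    (le_antisymm (by linarith) (Finset.sum_nonneg hnn))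
  -- Equality of the losses makes every excess term vanish. At an index strictly below the threshold
  -- this forces `m' i = 0`, and then equal fitted values at `b` and `b'`.
  refine sub_eq_zero.1 (hspan (b' - b) fun i hi => ?_)
  have hi0 := hz i (Finset.mem_univ i)
  have h1 := excess_nonneg (x := x) (y := y) hl b m' i
  have h2 : y i - m' i - inner ℝ (x i) b' - clippedResidual l x y b i = 0 :=
    pow_eq_zero_iff two_ne_zero |>.1 (le_antisymm (by linarith) (sq_nonneg _))
  have h3 : l * |m' i| - clippedResidual l x y b i * m' i = 0 := by
    rw [h2] at hi0; linarith
  have hc : clippedResidual l x y b i = y i - inner ℝ (x i) b :=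
    sub_softThreshold_of_abs_le hi.le
  rw [hc] at h2 h3
  have hm0 : m' i = 0 := by
    by_contra hne
    have : (y i - inner ℝ (x i) b) * m' i < l * |m' i| :=
      (le_abs_self _).trans_lt (by
        rw [abs_mul]; exact mul_lt_mul_of_pos_right hi (abs_pos.2 hne))
    linarith
  rw [inner_sub_right]
  rw [hm0] at h2
  linarith

lemma designMatrix_mulVec (b : EuclideanSpace ℝ (Fin d)) :
    (designMatrix x).mulVec b = fun i => inner ℝ (x i) b := by
  ext i
  simp [designMatrix, Matrix.mulVec, dotProduct, PiLp.inner_apply, mul_comm]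

lemma designMatrix_transpose_mulVec (w : Fin n → ℝ) :
    (designMatrix x).transpose.mulVec w = WithLp.ofLp (∑ i, w i • x i) := by
  ext j
  simp [designMatrix, Matrix.mulVec, dotProduct, mul_comm]

lemma isUnit_det_gram (hspan : ∀ v, (∀ i, inner ℝ (x i) v = 0) → v = 0) :
    IsUnit ((designMatrix x).transpose * designMatrix x).det := by
  rw [← Matrix.isUnit_iff_isUnit_det, ← Matrix.mulVec_injective_iff_isUnit]
  refine (injective_iff_map_eq_zero
    (Matrix.mulVecLin ((designMatrix x).transpose * designMatrix x))).2 fun v hv => ?_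
  have h1 : (designMatrix x).mulVec v = 0 := by
    have := Matrix.ker_mulVecLin_transpose_mul_self (designMatrix x)
    have h2 : v ∈ LinearMap.ker (designMatrix x).mulVecLin := by
      rw [← this]; exact hv
    simpa using h2
  have h3 := hspan (WithLp.toLp 2 v) fun i => by
    have := designMatrix_mulVec (x := x) (WithLp.toLp 2 v)
    rw [← congrFun this i]
    exact congrFun h1 i
  simpa using congrArg WithLp.ofLp h3

/-- Since `y - m(b)` is the fitted value `X b` plus the clipped residual, the estimating function is
minus the inverse Gram matrix applied to the score. -/
lemma estimatingFunction_eq_zero_iff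
    (hX : IsUnit ((designMatrix x).transpose * designMatrix x).det)
    (b : EuclideanSpace ℝ (Fin d)) :
    estimatingFunction l x y b = 0 ↔ ∑ i, clippedResidual l x y b i • x i = 0 := by
  have hdecomp : (designMatrix x).transpose.mulVec
      (fun i => y i - softThreshold l (y i - inner ℝ (x i) b)) =
      ((designMatrix x).transpose * designMatrix x).mulVec b +
        WithLp.ofLp (∑ i, clippedResidual l x y b i • x i) := by
    rw [← designMatrix_transpose_mulVec, ← Matrix.mulVec_mulVec, ← Matrix.mulVec_add,
      designMatrix_mulVec]
    congr 1
    ext i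
    simp only [Pi.add_apply, clippedResidual]
    ring
  rw [estimatingFunction, hdecomp, Matrix.mulVec_add, Matrix.mulVec_mulVec,
    Matrix.nonsing_inv_mul _ hX, Matrix.one_mulVec, WithLp.toLp_add]
  simp only [WithLp.toLp_ofLp, sub_add_cancel_left, neg_eq_zero]
  constructor
  · intro h
    have h2 := congrArg WithLp.ofLp h
    have h3 := congrArg
      (fun v => ((designMatrix x).transpose * designMatrix x).mulVec v) h2
    simp only [Matrix.mulVec_mulVec, Matrix.mul_nonsing_inv _ hX, Matrix.one_mulVec,
      WithLp.ofLp_zero, Matrix.mulVec_zero] at h3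
    simpa using congrArg (WithLp.toLp 2) h3
  · intro h
    simp [h]

/-- A root of the score whose small residuals belong to covariates spanning the space is the unique
penalized estimate and the unique root of the estimating function. -/
lemma unique_estimate_and_root (hl : 0 ≤ l) {b : EuclideanSpace ℝ (Fin d)}
    (hb : ∑ i, clippedResidual l x y b i • x i = 0)
    (hspan : ∀ v, (∀ i, |y i - inner ℝ (x i) b| < l → inner ℝ (x i) v = 0) → v = 0) :
    (∀ b', IsPenalizedEstimate l x y b' ↔ b' = b) ∧
      ∀ b', estimatingFunction l x y b' = 0 ↔ b' = b := by
  have hX := isUnit_det_gram (x := x) fun v hv => hspan v fun i _ => hv i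
  refine ⟨fun b' => ⟨fun h => h.eq_of_sum_eq_zero hl hb hspan, ?_⟩,
    fun b' => ⟨fun h => ?_, ?_⟩⟩
  · rintro rfl
    exact isPenalizedEstimate_of_sum_eq_zero hl hb
  · exact (isPenalizedEstimate_of_sum_eq_zero hl
      ((estimatingFunction_eq_zero_iff hX b').1 h)).eq_of_sum_eq_zero hl hb hspan
  · rintro rfl
    exact (estimatingFunction_eq_zero_iff hX b').2 hb

end Deterministic

/-! ### Reduction of the score equation to a linear system -/

/-- The Gram matrix `∑ xᵢ xᵢᵀ` of the covariates with index in `[s, n)`. -/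
noncomputable def tailGram {d : ℕ} (x : ℕ → EuclideanSpace ℝ (Fin d)) (s n : ℕ) :
    Matrix (Fin d) (Fin d) ℝ :=
  ∑ i ∈ Finset.Ico s n, Matrix.vecMulVec (x i) (x i)

lemma tailGram_mulVec {d : ℕ} (x : ℕ → EuclideanSpace ℝ (Fin d)) (s n : ℕ)
    (v : EuclideanSpace ℝ (Fin d)) :
    (tailGram x s n).mulVec v = WithLp.ofLp (∑ i ∈ Finset.Ico s n, (inner ℝ (x i) v : ℝ) • x i) := by
  simp only [tailGram, Matrix.sum_mulVec, Matrix.vecMulVec_mulVec, WithLp.ofLp_sum]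
  refine Finset.sum_congr rfl fun i _ => ?_
  ext j
  simp [PiLp.inner_apply, dotProduct, mul_comm]

/-- If the residuals at `b` lie beyond the threshold exactly for the indices below `s`, where they
have the sign of the incidental parameter, and `b` solves the resulting linear system, then `b` is
the unique penalized estimate and the unique root of the estimating function. -/
lemma unique_of_linear_system {d n s : ℕ} (hs : s ≤ n) {x : ℕ → EuclideanSpace ℝ (Fin d)}
    {e m : ℕ → ℝ} {β b : EuclideanSpace ℝ (Fin d)} {l k g : ℝ} (hl : 0 < l)
    (hkg : 2 * g + k < l) (hx : ∀ i < n, ‖x i‖ ≤ k) (he : ∀ i < n, |e i| ≤ g)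
    (hlarge : ∀ i < s, 4 * l ≤ |m i|) (hsmall : ∀ i, s ≤ i → i < n → |m i| ≤ g)
    (hb1 : ‖b - β‖ ≤ 1) (hdet : IsUnit (tailGram x s n).det)
    (hb : (tailGram x s n).mulVec (WithLp.ofLp (b - β)) = WithLp.ofLp
      (∑ i ∈ Finset.range s, (l * Real.sign (m i)) • x i +
        ∑ i ∈ Finset.Ico s n, (m i + e i) • x i)) :
    (∀ b', IsPenalizedEstimate l (fun i : Fin n => x i)
        (fun i : Fin n => m i + inner ℝ (x i) β + e i) b' ↔ b' = b) ∧
      ∀ b', estimatingFunction l (fun i : Fin n => x i)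
        (fun i : Fin n => m i + inner ℝ (x i) β + e i) b' = 0 ↔ b' = b := by
  have hres : ∀ i, m i + inner ℝ (x i) β + e i - inner ℝ (x i) b =
      m i + e i - inner ℝ (x i) (b - β) := fun i => by rw [inner_sub_right]; ring
  -- This is where `‖b - β‖ ≤ 1` enters: the unknown part of each residual is at most `k`.
  have hin : ∀ i < n, |inner ℝ (x i) (b - β)| ≤ k := fun i hi =>
    (abs_real_inner_le_norm _ _).trans (by nlinarith [hx i hi, norm_nonneg (x i)])
  have htail : ∀ i, s ≤ i → i < n → |m i + e i - inner ℝ (x i) (b - β)| < l := fun i h1 h2 => by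
    have a1 := abs_le.1 (hsmall i h1 h2)
    have a2 := abs_le.1 (he i h2)
    have a3 := abs_le.1 (hin i h2)
    rw [abs_lt]
    constructor <;> linarith
  -- A perturbation of size at most `g + k < l` can neither flip the sign of `m i` nor bring the
  -- residual below the threshold; the factor 4 is generous, 2 would do.
  have hhead : ∀ i < s, m i + e i - inner ℝ (x i) (b - β) -
      softThreshold l (m i + e i - inner ℝ (x i) (b - β)) = l * Real.sign (m i) := fun i hi => by
    have a1 := hlarge i hi
    have a2 := abs_le.1 (he i (hi.trans_le hs))
    have a3 := abs_le.1 (hin i (hi.trans_le hs))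
    have hg : 0 ≤ g := (abs_nonneg _).trans (he i (hi.trans_le hs))
    have hk : 0 ≤ k := (abs_nonneg _).trans (hin i (hi.trans_le hs))
    rcases le_total 0 (m i) with hm | hm
    · rw [abs_of_nonneg hm] at a1
      have hpos : 0 < m i + e i - inner ℝ (x i) (b - β) := by linarith
      rw [sub_softThreshold_of_le_abs, Real.sign_of_pos hpos,
        Real.sign_of_pos (by linarith : 0 < m i)]
      rw [abs_of_pos hpos]
      linarith
    · rw [abs_of_nonpos hm] at a1
      have hneg : m i + e i - inner ℝ (x i) (b - β) < 0 := by linarith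
      rw [sub_softThreshold_of_le_abs, Real.sign_of_neg hneg,
        Real.sign_of_neg (by linarith : m i < 0)]
      rw [abs_of_neg hneg]
      linarith
  refine unique_estimate_and_root hl.le ?_ fun v hv => ?_
  · simp only [clippedResidual, hres]
    rw [Fin.sum_univ_eq_sum_range (fun i => (m i + e i - inner ℝ (x i) (b - β) -
      softThreshold l (m i + e i - inner ℝ (x i) (b - β))) • x i) n,
      ← Finset.sum_range_add_sum_Ico _ hs,
      Finset.sum_congr rfl fun i hi => by rw [hhead i (Finset.mem_range.1 hi)],
      Finset.sum_congr (s₁ := Finset.Ico s n) rfl fun i hi => by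
        rw [sub_softThreshold_of_abs_le
          (htail i (Finset.mem_Ico.1 hi).1 (Finset.mem_Ico.1 hi).2).le, sub_smul],
      Finset.sum_sub_distrib]
    have := congrArg (WithLp.toLp 2) hb
    rw [tailGram_mulVec, WithLp.toLp_ofLp, WithLp.toLp_ofLp] at this
    rw [this]
    abel
  · have h0 : (tailGram x s n).mulVec v = 0 := by
      rw [tailGram_mulVec, Finset.sum_eq_zero, WithLp.ofLp_zero]
      intro i hi
      have hi' := Finset.mem_Ico.1 hi
      rw [hv ⟨i, hi'.2⟩ (by simpa only [hres] using htail i hi'.1 hi'.2), zero_smul]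
    have h1 := congrArg (fun w => (tailGram x s n)⁻¹.mulVec w) h0
    simp only [Matrix.mulVec_mulVec, Matrix.nonsing_inv_mul _ hdet, Matrix.one_mulVec,
      Matrix.mulVec_zero] at h1
    simpa using congrArg (WithLp.toLp 2) h1

/-! ### Independence of pairs and characteristic-function estimates -/

/-- Two independent sequences of independent random variables form a sequence of independent
pairs. -/
lemma iIndepFun.pair_of_indepFun {Ω ι α β : Type*} [MeasurableSpace Ω] {P : Measure Ω}
    [Countable ι] [MeasurableSpace α] [MeasurableSpace β] {X : ι → Ω → α} {Y : ι → Ω → β}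
    (hXm : ∀ i, AEMeasurable (X i) P) (hYm : ∀ i, AEMeasurable (Y i) P)
    (hX : iIndepFun X P) (hY : iIndepFun Y P)
    (hXY : IndepFun (fun ω i => X i ω) (fun ω i => Y i ω) P) :
    iIndepFun (fun i ω => (X i ω, Y i ω)) P := by
  wlog hm : (∀ i, Measurable (X i)) ∧ ∀ i, Measurable (Y i) generalizing X Y
  · have hX' : ∀ i, X i =ᵐ[P] (hXm i).mk := fun i => (hXm i).ae_eq_mk
    have hY' : ∀ i, Y i =ᵐ[P] (hYm i).mk := fun i => (hYm i).ae_eq_mk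
    have := this (X := fun i => (hXm i).mk) (Y := fun i => (hYm i).mk)
      (fun i => (hXm i).measurable_mk.aemeasurable) (fun i => (hYm i).measurable_mk.aemeasurable)
      (hX.congr hX') (hY.congr hY')
      (hXY.congr (by filter_upwards [ae_all_iff.2 hX'] with ω h using funext h)
        (by filter_upwards [ae_all_iff.2 hY'] with ω h using funext h))
      ⟨fun i => (hXm i).measurable_mk, fun i => (hYm i).measurable_mk⟩
    refine this.congr fun i => ?_
    filter_upwards [hX' i, hY' i] with ω h1 h2
    rw [h1, h2]
  obtain ⟨mX, mY⟩ := hm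
  -- The preimages of measurable rectangles form a π-system generating the σ-algebra of each pair,
  -- so independence need only be tested on them.
  let π : ι → Set (Set Ω) := fun i => Set.image2 (fun A B => X i ⁻¹' A ∩ Y i ⁻¹' B)
    {A | MeasurableSet A} {B | MeasurableSet B}
  refine iIndepSets.iIndep (fun i => ((mX i).prodMk (mY i)).comap_le) π ?_ ?_ ?_
  · rintro i _ ⟨A, hA, B, hB, rfl⟩ _ ⟨A', hA', B', hB', rfl⟩ -
    refine ⟨A ∩ A', MeasurableSet.inter hA hA', B ∩ B', MeasurableSet.inter hB hB', ?_⟩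
    ext; simp only [Set.mem_inter_iff, Set.mem_preimage]; tauto
  · intro i
    rw [← generateFrom_prod, MeasurableSpace.comap_generateFrom]
    congr 1
    ext s
    constructor
    · rintro ⟨_, ⟨A, hA, B, hB, rfl⟩, rfl⟩
      exact ⟨A, hA, B, hB, rfl⟩
    · rintro ⟨A, hA, B, hB, rfl⟩
      exact ⟨_, ⟨A, hA, B, hB, rfl⟩, rfl⟩
  · rw [iIndepSets_iff]
    intro s f hf
    choose! A hA B hB hAB using hf
    have h1 : ⋂ i ∈ s, f i = (⋂ i ∈ s, X i ⁻¹' A i) ∩ ⋂ i ∈ s, Y i ⁻¹' B i := by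
      rw [← Set.iInter_inter_distrib]
      refine Set.iInter_congr fun i => ?_
      rw [← Set.iInter_inter_distrib]
      exact Set.iInter_congr fun hi => (hAB i hi).symm
    have hsX : (⋂ i ∈ s, X i ⁻¹' A i) = (fun ω i => X i ω) ⁻¹' (⋂ i ∈ s, (fun x => x i) ⁻¹' A i) := by
      ext; simp
    have hsY : (⋂ i ∈ s, Y i ⁻¹' B i) = (fun ω i => Y i ω) ⁻¹' (⋂ i ∈ s, (fun x => x i) ⁻¹' B i) := by
      ext; simp
    rw [h1, hsX, hsY, hXY.measure_inter_preimage_eq_mul _ _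
      (Finset.measurableSet_biInter s fun i hi => measurable_pi_apply i (hA i hi))
      (Finset.measurableSet_biInter s fun i hi => measurable_pi_apply i (hB i hi)),
      ← hsX, ← hsY, hX.measure_inter_preimage_eq_mul _ hA, hY.measure_inter_preimage_eq_mul _ hB,
      ← Finset.prod_mul_distrib]
    refine Finset.prod_congr rfl fun i hi => ?_
    rw [← hAB i hi]
    have hi2 : IndepFun (X i) (Y i) P :=
      hXY.comp (φ := fun x : ι → α => x i) (ψ := fun y : ι → β => y i) (measurable_pi_apply i)
        (measurable_pi_apply i)
    exact (hi2.measure_inter_preimage_eq_mul _ _ (hA i hi) (hB i hi)).symm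

/-- A product of complex numbers of norm at most one depends on its factors in a Lipschitz way. -/
lemma norm_prod_sub_prod_le {ι : Type*} (s : Finset ι) {f g : ι → ℂ}
    (hf : ∀ i ∈ s, ‖f i‖ ≤ 1) (hg : ∀ i ∈ s, ‖g i‖ ≤ 1) :
    ‖∏ i ∈ s, f i - ∏ i ∈ s, g i‖ ≤ ∑ i ∈ s, ‖f i - g i‖ := by
  classical
  induction s using Finset.induction_on with
  | empty => simp
  | insert a s ha ih =>
    rw [Finset.prod_insert ha, Finset.prod_insert ha, Finset.sum_insert ha]
    have h1 : ‖∏ i ∈ s, f i‖ ≤ 1 := by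
      rw [norm_prod]
      exact Finset.prod_le_one (fun _ _ => norm_nonneg _)
        fun i hi => hf i (Finset.mem_insert_of_mem hi)
    have h2 := hg a (Finset.mem_insert_self a s)
    have h3 := ih (fun i hi => hf i (Finset.mem_insert_of_mem hi))
      (fun i hi => hg i (Finset.mem_insert_of_mem hi))
    calc ‖f a * ∏ i ∈ s, f i - g a * ∏ i ∈ s, g i‖
        = ‖(f a - g a) * ∏ i ∈ s, f i + g a * (∏ i ∈ s, f i - ∏ i ∈ s, g i)‖ := by ring_nf
      _ ≤ ‖f a - g a‖ * ‖∏ i ∈ s, f i‖ + ‖g a‖ * ‖∏ i ∈ s, f i - ∏ i ∈ s, g i‖ :=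
        (norm_add_le _ _).trans (by rw [norm_mul, norm_mul])
      _ ≤ _ := add_le_add (mul_le_of_le_one_right (norm_nonneg _) h1)
        ((mul_le_of_le_one_left (norm_nonneg _) h2).trans h3)

/-- Second-order expansion at `0` of the characteristic function of a centred square-integrable
random variable, written relative to the Gaussian characteristic function. -/
lemma charFun_sub_exp_isLittleO {Ω : Type*} [MeasurableSpace Ω] {P : Measure Ω}
    [IsProbabilityMeasure P] {W : Ω → ℝ} (hW : MemLp W 2 P) (h0 : ∫ ω, W ω ∂P = 0) :
    (fun u : ℝ => charFun (P.map W) u - Complex.exp (-((u ^ 2 * ∫ ω, W ω ^ 2 ∂P : ℝ) : ℂ) / 2))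
      =o[𝓝 0] fun u => u ^ 2 := by
  set v := ∫ ω, W ω ^ 2 ∂P with hv
  have : IsProbabilityMeasure (P.map W) := Measure.isProbabilityMeasure_map hW.aemeasurable
  have hint : MemLp id 2 (P.map W) := by
    rw [memLp_map_measure_iff (by fun_prop) hW.aemeasurable]; exact hW
  have h1 : (fun u : ℝ => charFun (P.map W) u - (1 - ((u ^ 2 * v : ℝ) : ℂ) / 2))
      =o[𝓝 0] fun u => u ^ 2 := by
    have := taylor_isLittleO_univ (x₀ := 0) (n := 2) (f := charFun (P.map W))
      (contDiff_charFun (by exact_mod_cast hint))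
    simp only [sub_zero] at this
    refine this.congr_left fun u => ?_
    have hv' : ∫ ω, (W ^ 2) ω ∂P = v := hv.symm
    rw [taylorWithinEval_charFun_two_zero hW.aemeasurable hint, h0, hv']
    push_cast
    ring
  have h2 : (fun u : ℝ => Complex.exp (-((u ^ 2 * v : ℝ) : ℂ) / 2) -
      (1 - ((u ^ 2 * v : ℝ) : ℂ) / 2)) =o[𝓝 0] fun u => u ^ 2 := by
    have hd : (fun z : ℂ => Complex.exp z - 1 - z) =o[𝓝 0] fun z => z := by
      have := (Complex.hasDerivAt_exp 0).isLittleO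
      simpa using this
    have ht : Tendsto (fun u : ℝ => -((u ^ 2 * v : ℝ) : ℂ) / 2) (𝓝 0) (𝓝 0) := by
      have : Continuous (fun u : ℝ => -((u ^ 2 * v : ℝ) : ℂ) / 2) := by fun_prop
      simpa using this.tendsto 0
    refine ((hd.comp_tendsto ht).congr_left fun u => ?_).trans_isBigO ?_
    · simp only [Function.comp]; ring
    · refine IsBigO.of_bound (|v| / 2) (Eventually.of_forall fun u => ?_)
      simp only [Function.comp, norm_div, norm_neg, Complex.norm_real, norm_mul, norm_pow,
        Real.norm_eq_abs, Complex.norm_ofNat]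
      exact le_of_eq (by ring)
  exact (h1.sub h2).congr_left fun u => by ring

/-- A product of characteristic-function factors at arguments of common size `a n → 0`, with
`k n * a n ^ 2 → A` for the number of factors `k n`, converges to a Gaussian limit. -/
lemma tendsto_prod_of_isLittleO {f : ℝ → ℂ} {v A : ℝ} (hv : 0 ≤ v) (hf : ∀ u, ‖f u‖ ≤ 1)
    (ho : (fun u : ℝ => f u - Complex.exp (-((u ^ 2 * v : ℝ) : ℂ) / 2)) =o[𝓝 0] fun u => u ^ 2)
    {I : ℕ → Finset ℕ} {w : ℕ → ℕ → ℝ} {a : ℕ → ℝ} (ha : Tendsto a atTop (𝓝 0))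
    (hw : ∀ᶠ n in atTop, ∀ i ∈ I n, |w n i| = |a n|)
    (hA : Tendsto (fun n => ((I n).card : ℝ) * a n ^ 2) atTop (𝓝 A)) :
    Tendsto (fun n => ∏ i ∈ I n, f (w n i)) atTop (𝓝 (Complex.exp (-((A * v : ℝ) : ℂ) / 2))) := by
  set g : ℝ → ℂ := fun u => Complex.exp (-((u ^ 2 * v : ℝ) : ℂ) / 2) with hg
  have hg1 : ∀ u, ‖g u‖ ≤ 1 := fun u => by
    rw [hg, Complex.norm_exp, Real.exp_le_one_iff]
    have : (-((u ^ 2 * v : ℝ) : ℂ) / 2).re = -(u ^ 2 * v) / 2 := by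
      rw [← Complex.ofReal_neg, ← Complex.ofReal_ofNat, ← Complex.ofReal_div, Complex.ofReal_re]
    rw [this]
    have := mul_nonneg (sq_nonneg u) hv
    linarith
  have hprod : Tendsto (fun n => ∏ i ∈ I n, g (w n i)) atTop
      (𝓝 (Complex.exp (-((A * v : ℝ) : ℂ) / 2))) := by
    have h1 : Tendsto (fun n => Complex.exp (-(((I n).card * a n ^ 2 * v : ℝ) : ℂ) / 2)) atTop
        (𝓝 (Complex.exp (-((A * v : ℝ) : ℂ) / 2))) := by
      have hc : Continuous fun s : ℝ => Complex.exp (-((s * v : ℝ) : ℂ) / 2) := by fun_prop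
      exact (hc.tendsto A).comp hA
    refine h1.congr' ?_
    filter_upwards [hw] with n hn
    have hgi : ∀ i ∈ I n, g (w n i) = Complex.exp (-((a n ^ 2 * v : ℝ) : ℂ) / 2) :=
      fun i hi => by rw [hg, ← sq_abs (a n), ← hn i hi, sq_abs]
    rw [Finset.prod_congr rfl hgi, Finset.prod_const, ← Complex.exp_nat_mul]
    congr 1
    push_cast
    ring
  have hdiff : Tendsto (fun n => ∏ i ∈ I n, f (w n i) - ∏ i ∈ I n, g (w n i)) atTop (𝓝 0) := by
    rw [Metric.tendsto_atTop']
    intro ε hε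
    have hA0 : 0 ≤ |A| := abs_nonneg A
    -- Eventually `card * a n ^ 2 < |A| + 1`, so this choice keeps the total error strictly below
    -- `ε`.
    have hc : 0 < ε / (|A| + 2) := by positivity
    obtain ⟨δ, hδ, hδf⟩ := Metric.eventually_nhds_iff.1 (ho.def hc)
    have e1 : ∀ᶠ n in atTop, |a n| < δ := by
      have := (Metric.tendsto_nhds.1 ha) δ hδ
      simpa using this
    have e2 : ∀ᶠ n in atTop, ((I n).card : ℝ) * a n ^ 2 < |A| + 1 :=
      hA.eventually_lt_const (by linarith [le_abs_self A])
    have := hw.and (e1.and e2)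
    obtain ⟨N, hN⟩ := eventually_atTop.1 this
    refine ⟨N, fun n hn => ?_⟩
    obtain ⟨h1, h2, h3⟩ := hN n hn.le
    rw [dist_zero_right]
    calc _ ≤ ∑ i ∈ I n, ‖f (w n i) - g (w n i)‖ :=
          norm_prod_sub_prod_le _ (fun i _ => hf _) fun i _ => hg1 _
      _ ≤ ∑ i ∈ I n, ε / (|A| + 2) * a n ^ 2 := by
          refine Finset.sum_le_sum fun i hi => ?_
          have := hδf (y := w n i) (by rw [dist_zero_right, Real.norm_eq_abs, h1 i hi]; exact h2)
          rwa [norm_pow, Real.norm_eq_abs, h1 i hi, sq_abs] at this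
      _ = ε / (|A| + 2) * ((I n).card * a n ^ 2) := by
          rw [Finset.sum_const, nsmul_eq_mul]; ring
      _ ≤ ε / (|A| + 2) * (|A| + 1) := by gcongr
      _ < ε := by
          rw [div_mul_eq_mul_div, div_lt_iff₀ (by positivity)]
          nlinarith
  simpa using hdiff.add hprod

/-! ### Central limit theorem for the clipped and noise blocks -/

section BlockCLT

variable {Ω : Type*} [MeasurableSpace Ω] {P : Measure Ω} {d : ℕ}

lemma charFun_map_smul_eq {U : Ω → EuclideanSpace ℝ (Fin d)} (hU : AEMeasurable U P) (u : ℝ)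
    (t : EuclideanSpace ℝ (Fin d)) :
    charFun (P.map fun ω => u • U ω) t = charFun (P.map fun ω => (inner ℝ (U ω) t : ℝ)) u := by
  rw [charFun_apply, charFun_apply_real, integral_map (by fun_prop) (by fun_prop),
    integral_map (by fun_prop) (by fun_prop)]
  simp [real_inner_smul_left]

lemma memLp_coord {Z : Ω → EuclideanSpace ℝ (Fin d)} (hZ : MemLp Z 2 P) (j : Fin d) :
    MemLp (fun ω => Z ω j) 2 P :=
  (EuclideanSpace.proj (𝕜 := ℝ) j).comp_memLp' hZ

variable [IsProbabilityMeasure P]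

lemma integral_coord {Z : Ω → EuclideanSpace ℝ (Fin d)} (hZ : MemLp Z 2 P)
    (h0 : ∫ ω, Z ω ∂P = 0) (j : Fin d) : ∫ ω, Z ω j ∂P = 0 := by
  have := (EuclideanSpace.proj (𝕜 := ℝ) j).integral_comp_comm (hZ.integrable one_le_two)
  rw [h0] at this
  simpa using this

lemma integral_coord_mul_coord {Z : Ω → EuclideanSpace ℝ (Fin d)} (hZ : MemLp Z 2 P)
    (h0 : ∫ ω, Z ω ∂P = 0) (j k : Fin d) :
    ∫ ω, Z ω j * Z ω k ∂P = covarianceMatrix P Z j k := by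
  have := covariance_eq_sub (memLp_coord hZ j) (memLp_coord hZ k)
  simp only [integral_coord hZ h0, mul_zero, sub_zero] at this
  simp only [covarianceMatrix, Matrix.of_apply, this]
  rfl

lemma integral_inner_sq {Z : Ω → EuclideanSpace ℝ (Fin d)} (hZ : MemLp Z 2 P)
    (h0 : ∫ ω, Z ω ∂P = 0) (t : EuclideanSpace ℝ (Fin d)) :
    ∫ ω, (inner ℝ (Z ω) t : ℝ) ^ 2 ∂P =
      WithLp.ofLp t ⬝ᵥ (covarianceMatrix P Z).mulVec (WithLp.ofLp t) := by
  have hexp : ∀ ω, (inner ℝ (Z ω) t : ℝ) ^ 2 =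
      ∑ j, ∑ k, t j * t k * (Z ω j * Z ω k) := fun ω => by
    rw [PiLp.inner_apply, sq, Finset.sum_mul_sum]
    refine Finset.sum_congr rfl fun j _ => Finset.sum_congr rfl fun k _ => ?_
    simp only [RCLike.inner_apply, conj_trivial]
    ring
  have hint : ∀ j k, Integrable (fun ω => t j * t k * (Z ω j * Z ω k)) P := fun j k =>
    ((memLp_coord hZ j).integrable_mul (memLp_coord hZ k)).const_mul _
  simp_rw [hexp]
  rw [integral_finsetSum _ fun j _ => integrable_finsetSum _ fun k _ => hint j k]
  simp only [dotProduct, Matrix.mulVec, Finset.mul_sum]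
  refine Finset.sum_congr rfl fun j _ => ?_
  rw [integral_finsetSum _ fun k _ => hint j k]
  refine Finset.sum_congr rfl fun k _ => ?_
  rw [integral_const_mul, integral_coord_mul_coord hZ h0]
  ring

lemma integral_inner_eq_zero {Z : Ω → EuclideanSpace ℝ (Fin d)} (hZ : MemLp Z 2 P)
    (h0 : ∫ ω, Z ω ∂P = 0) (t : EuclideanSpace ℝ (Fin d)) : ∫ ω, (inner ℝ (Z ω) t : ℝ) ∂P = 0 := by
  have := integral_inner (𝕜 := ℝ) (hZ.integrable one_le_two) t
  rw [h0, inner_zero_right] at this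
  simpa only [real_inner_comm] using this

/-- Central limit theorem for a sum of two blocks: the covariates `Xᵢ` with weights of common
size `|a n|` for `i < s n`, and the products `c n * εᵢ * Xᵢ` for `s n ≤ i < n`. -/
theorem tendstoInDistribution_two_blocks {X : ℕ → Ω → EuclideanSpace ℝ (Fin d)} {ε : ℕ → Ω → ℝ}
    {σ : ℝ} (hXindep : iIndepFun X P) (hXid : ∀ i, IdentDistrib (X i) (X 0) P P)
    (hXmem : MemLp (X 0) 2 P) (hXmean : ∫ ω, X 0 ω ∂P = 0)
    (hXcov : (covarianceMatrix P (X 0)).PosSemidef)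
    (hεindep : iIndepFun ε P) (hεid : ∀ i, IdentDistrib (ε i) (ε 0) P P)
    (hεmem : MemLp (ε 0) 2 P) (hεmean : ∫ ω, ε 0 ω ∂P = 0) (hεvar : Var[ε 0; P] = σ ^ 2)
    (hXε : IndepFun (fun ω i => X i ω) (fun ω i => ε i ω) P)
    {s : ℕ → ℕ} (hs : ∀ n, s n ≤ n) {w : ℕ → ℕ → ℝ} {a c : ℕ → ℝ} {A B : ℝ}
    (ha : Tendsto a atTop (𝓝 0)) (hc : Tendsto c atTop (𝓝 0))
    (hw : ∀ᶠ n in atTop, ∀ i < s n, |w n i| = |a n|)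
    (hA : Tendsto (fun n => (s n : ℝ) * a n ^ 2) atTop (𝓝 A))
    (hB : Tendsto (fun n => ((n - s n : ℕ) : ℝ) * c n ^ 2) atTop (𝓝 B)) :
    TendstoInDistribution (fun n ω => ∑ i ∈ Finset.range (s n), w n i • X i ω +
        ∑ i ∈ Finset.Ico (s n) n, (c n * ε i ω) • X i ω) atTop
      (id : EuclideanSpace ℝ (Fin d) → EuclideanSpace ℝ (Fin d)) (fun _ => P)
      (multivariateGaussian 0 ((A + B * σ ^ 2) • covarianceMatrix P (X 0))) := by
  have mX : ∀ i, AEMeasurable (X i) P := fun i => (hXid i).aemeasurable_fst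
  have mε : ∀ i, AEMeasurable (ε i) P := fun i => (hεid i).aemeasurable_fst
  have hA0 : 0 ≤ A := ge_of_tendsto' hA fun n => by positivity
  have hB0 : 0 ≤ B := ge_of_tendsto' hB fun n => by positivity
  have hS : ((A + B * σ ^ 2) • covarianceMatrix P (X 0)).PosSemidef :=
    hXcov.smul (by positivity)
  refine ⟨fun n => by fun_prop, aemeasurable_id, ?_⟩
  refine ProbabilityMeasure.tendsto_iff_tendsto_charFun.2 fun t => ?_
  simp only [ProbabilityMeasure.coe_mk, Measure.map_id]
  rw [charFun_multivariateGaussian hS]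
  have hpair := iIndepFun.pair_of_indepFun mX mε hXindep hεindep hXε
  have hpairid : ∀ i, IdentDistrib (fun ω => (X i ω, ε i ω)) (fun ω => (X 0 ω, ε 0 ω)) P P :=
    fun i => (hXid i).prodMk (hεid i)
      (hXε.comp (φ := fun x : ℕ → EuclideanSpace ℝ (Fin d) => x i) (ψ := fun y : ℕ → ℝ => y i)
        (measurable_pi_apply i) (measurable_pi_apply i))
      (hXε.comp (φ := fun x : ℕ → EuclideanSpace ℝ (Fin d) => x 0) (ψ := fun y : ℕ → ℝ => y 0)
        (measurable_pi_apply 0) (measurable_pi_apply 0))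
  have hX0ε0 : IndepFun (X 0) (ε 0) P :=
    hXε.comp (φ := fun x : ℕ → EuclideanSpace ℝ (Fin d) => x 0) (ψ := fun y : ℕ → ℝ => y 0)
        (measurable_pi_apply 0) (measurable_pi_apply 0)
  let f₁ : ℝ → ℂ := charFun (P.map fun ω => (inner ℝ (X 0 ω) t : ℝ))
  let f₂ : ℝ → ℂ := charFun (P.map fun ω => (inner ℝ (ε 0 ω • X 0 ω) t : ℝ))
  set q : ℝ := WithLp.ofLp t ⬝ᵥ (covarianceMatrix P (X 0)).mulVec (WithLp.ofLp t) with hq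
  have hq0 : 0 ≤ q := by
    rw [hq, ← integral_inner_sq hXmem hXmean]; exact integral_nonneg fun ω => sq_nonneg _
  have mem1 : MemLp (fun ω => (inner ℝ (X 0 ω) t : ℝ)) 2 P := hXmem.inner_const t
  have hindt : IndepFun (ε 0) (fun ω => (inner ℝ (X 0 ω) t : ℝ)) P :=
    hX0ε0.symm.comp (φ := id) (ψ := fun x => inner ℝ x t) measurable_id (by fun_prop)
  have hindt2 : IndepFun (fun ω => ε 0 ω ^ 2) (fun ω => (inner ℝ (X 0 ω) t : ℝ) ^ 2) P :=
    hindt.comp (φ := fun x => x ^ 2) (ψ := fun x => x ^ 2) (by fun_prop) (by fun_prop)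
  have hf2eq : ∀ ω, (inner ℝ (ε 0 ω • X 0 ω) t : ℝ) = ε 0 ω * inner ℝ (X 0 ω) t := fun ω =>
    real_inner_smul_left _ _ _
  -- Independence factors the second moment, so second moments of `ε 0` and `X 0` suffice.
  have mem2 : MemLp (fun ω => (inner ℝ (ε 0 ω • X 0 ω) t : ℝ)) 2 P := by
    simp only [hf2eq]
    rw [memLp_two_iff_integrable_sq (by fun_prop)]
    simp only [mul_pow]
    exact hindt2.integrable_mul hεmem.integrable_sq mem1.integrable_sq
  have mean2 : ∫ ω, (inner ℝ (ε 0 ω • X 0 ω) t : ℝ) ∂P = 0 := by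
    simp only [hf2eq]
    rw [hindt.integral_fun_mul_eq_mul_integral (by fun_prop) (by fun_prop), hεmean, zero_mul]
  have var2 : ∫ ω, (inner ℝ (ε 0 ω • X 0 ω) t : ℝ) ^ 2 ∂P = σ ^ 2 * q := by
    simp only [hf2eq, mul_pow]
    rw [hindt2.integral_fun_mul_eq_mul_integral (by fun_prop) (by fun_prop),
      integral_inner_sq hXmem hXmean, ← hεvar, variance_of_integral_eq_zero (mε 0) hεmean]
  have lim1 : Tendsto (fun n => ∏ i ∈ Finset.range (s n), f₁ (w n i)) atTop
      (𝓝 (Complex.exp (-((A * q : ℝ) : ℂ) / 2))) := by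
    have : IsProbabilityMeasure (P.map fun ω => (inner ℝ (X 0 ω) t : ℝ)) :=
      Measure.isProbabilityMeasure_map (by fun_prop)
    refine tendsto_prod_of_isLittleO hq0 (fun u => norm_charFun_le_one u) ?_ ha
      (by simpa using hw) (by simpa using hA)
    have := charFun_sub_exp_isLittleO mem1 (integral_inner_eq_zero hXmem hXmean t)
    rwa [integral_inner_sq hXmem hXmean] at this
  have lim2 : Tendsto (fun n => ∏ i ∈ Finset.Ico (s n) n, f₂ (c n)) atTop
      (𝓝 (Complex.exp (-((B * (σ ^ 2 * q) : ℝ) : ℂ) / 2))) := by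
    have : IsProbabilityMeasure (P.map fun ω => (inner ℝ (ε 0 ω • X 0 ω) t : ℝ)) :=
      Measure.isProbabilityMeasure_map (by fun_prop)
    refine tendsto_prod_of_isLittleO (by positivity) (fun u => norm_charFun_le_one u) ?_ hc
      (w := fun n _ => c n) (by simp) (by simpa using hB)
    have := charFun_sub_exp_isLittleO mem2 mean2
    rwa [var2] at this
  have hchar : ∀ n, charFun (P.map fun ω => ∑ i ∈ Finset.range (s n), w n i • X i ω +
        ∑ i ∈ Finset.Ico (s n) n, (c n * ε i ω) • X i ω) t =
      (∏ i ∈ Finset.range (s n), f₁ (w n i)) * ∏ i ∈ Finset.Ico (s n) n, f₂ (c n) := fun n => by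
    -- Both blocks involve the covariates, but each index contributes to only one of them, so the
    -- whole score is one sum of independent terms.
    let Z : ℕ → Ω → EuclideanSpace ℝ (Fin d) := fun i ω =>
      if i < s n then w n i • X i ω else (c n * ε i ω) • X i ω
    have hZm : ∀ i, AEMeasurable (Z i) P := fun i => by
      by_cases hi : i < s n <;> simp only [Z, hi, if_true, if_false] <;> fun_prop
    have hZ : iIndepFun Z P := by
      refine hpair.comp (fun i p => if i < s n then w n i • p.1 else (c n * p.2) • p.1)
        fun i => ?_
      by_cases hi : i < s n <;> simp only [hi, if_true, if_false] <;> fun_prop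
    have hsum : (fun ω => ∑ i ∈ Finset.range (s n), w n i • X i ω +
        ∑ i ∈ Finset.Ico (s n) n, (c n * ε i ω) • X i ω) =
        fun ω => ∑ i ∈ Finset.range n, Z i ω := by
      ext1 ω
      rw [← Finset.sum_range_add_sum_Ico _ (hs n)]
      congr 1
      · exact Finset.sum_congr rfl fun i hi => by simp [Z, Finset.mem_range.1 hi]
      · exact Finset.sum_congr rfl fun i hi => by
          simp [Z, not_lt.2 (Finset.mem_Ico.1 hi).1]
    rw [hsum, iIndepFun.charFun_map_fun_finsetSum_eq_prod (fun i _ => hZm i) (hZ.restrict _),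
      Finset.prod_apply, ← Finset.prod_range_mul_prod_Ico _ (hs n)]
    congr 1
    · refine Finset.prod_congr rfl fun i hi => ?_
      have : Z i = fun ω => w n i • X i ω := by ext1 ω; simp [Z, Finset.mem_range.1 hi]
      rw [this]
      have hid := ((hXid i).comp (u := fun x => w n i • x) (by fun_prop)).map_eq
      simp only [Function.comp_def] at hid
      rw [hid, charFun_map_smul_eq (mX 0)]
    · refine Finset.prod_congr rfl fun i hi => ?_
      have : Z i = fun ω => c n • (ε i ω • X i ω) := by
        ext1 ω; simp [Z, not_lt.2 (Finset.mem_Ico.1 hi).1, mul_smul]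
      rw [this]
      have hid := ((hpairid i).comp (u := fun p => c n • (p.2 • p.1)) (by fun_prop)).map_eq
      simp only [Function.comp_def] at hid
      rw [hid, charFun_map_smul_eq (by fun_prop)]
  simp only [hchar]
  convert lim1.mul lim2 using 2
  rw [← Complex.exp_add]
  congr 1
  rw [Matrix.smul_mulVec, dotProduct_smul, ← hq]
  simp
  ring

end BlockCLT

/-! ### Law of large numbers for the Gram matrix and its inverse -/

section LawOfLargeNumbers

/-- Cesàro means are unaffected by the omission of an initial segment of negligible length. -/
lemma tendsto_sum_Ico_div {u : ℕ → ℝ} {L : ℝ}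
    (hu : Tendsto (fun n : ℕ => (∑ i ∈ Finset.range n, u i) / n) atTop (𝓝 L))
    {s : ℕ → ℕ} (hs : ∀ n, s n ≤ n) (hso : (fun n => (s n : ℝ)) =o[atTop] fun n => (n : ℝ)) :
    Tendsto (fun n : ℕ => (∑ i ∈ Finset.Ico (s n) n, u i) / n) atTop (𝓝 L) := by
  obtain ⟨C, hC⟩ := hu.abs.bddAbove_range
  -- Convergent means are bounded, so the omitted segment contributes at most `C * s n / n`.
  have hb : ∀ m : ℕ, |∑ i ∈ Finset.range m, u i| ≤ C * m := fun m => by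
    rcases Nat.eq_zero_or_pos m with rfl | hm
    · simp
    · have := hC ⟨m, rfl⟩
      simp only [abs_div, Nat.abs_cast] at this
      rwa [div_le_iff₀ (by positivity)] at this
  have h0 : Tendsto (fun n : ℕ => (∑ i ∈ Finset.range (s n), u i) / n) atTop (𝓝 0) := by
    have h1 : Tendsto (fun n : ℕ => C * ((s n : ℝ) / n)) atTop (𝓝 0) := by
      simpa using hso.tendsto_div_nhds_zero.const_mul C
    refine squeeze_zero_norm (fun n => ?_) h1
    rw [Real.norm_eq_abs, abs_div, Nat.abs_cast, ← mul_div_assoc]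
    exact div_le_div_of_nonneg_right (hb _) (by positivity)
  have := hu.sub h0
  rw [sub_zero] at this
  refine this.congr fun n => ?_
  rw [← Finset.sum_range_add_sum_Ico _ (hs n)]
  ring

lemma tendsto_matrix_inv {d : ℕ} {A : ℕ → Matrix (Fin d) (Fin d) ℝ} {S : Matrix (Fin d) (Fin d) ℝ}
    (hA : Tendsto A atTop (𝓝 S)) (hS : S.det ≠ 0) :
    Tendsto (fun n => (A n)⁻¹) atTop (𝓝 S⁻¹) := by
  simp only [Matrix.inv_def, Ring.inverse_eq_inv']
  have h1 : Tendsto (fun n => (A n).det) atTop (𝓝 S.det) :=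
    ((continuous_id.matrix_det).tendsto S).comp hA
  have h2 : Tendsto (fun n => (A n).adjugate) atTop (𝓝 S.adjugate) :=
    ((continuous_id.matrix_adjugate).tendsto S).comp hA
  exact (h1.inv₀ hS).smul h2

lemma measurable_matrix_inv {d : ℕ} :
    Measurable fun (A : Fin d → Fin d → ℝ) (j k : Fin d) => (Matrix.of A)⁻¹ j k := by
  have hof : Continuous fun A : Fin d → Fin d → ℝ => Matrix.of A := continuous_id
  have h1 : Measurable fun A : Fin d → Fin d → ℝ => (Matrix.of A).det :=
    hof.matrix_det.measurable
  refine measurable_pi_iff.2 fun j => measurable_pi_iff.2 fun k => ?_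
  have h2 : Measurable fun A : Fin d → Fin d → ℝ => (Matrix.of A).adjugate j k :=
    (hof.matrix_adjugate.matrix_elem j k).measurable
  simp only [Matrix.inv_def, Ring.inverse_eq_inv', Matrix.smul_apply, smul_eq_mul]
  exact h1.inv.mul h2

variable {Ω : Type*} [MeasurableSpace Ω] {P : Measure Ω} {d : ℕ}
  {X : ℕ → Ω → EuclideanSpace ℝ (Fin d)} {s : ℕ → ℕ}

lemma aemeasurable_tailGram (mX : ∀ i, AEMeasurable (X i) P) (m n : ℕ) :
    AEMeasurable (fun ω (j k : Fin d) => tailGram (fun i => X i ω) m n j k) P := by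
  refine aemeasurable_pi_iff.2 fun j => aemeasurable_pi_iff.2 fun k => ?_
  simp only [tailGram, Matrix.sum_apply, Matrix.vecMulVec_apply]
  fun_prop

lemma aemeasurable_tailGram_inv (mX : ∀ i, AEMeasurable (X i) P) (m n : ℕ) :
    AEMeasurable (fun ω (j k : Fin d) => (tailGram (fun i => X i ω) m n)⁻¹ j k) P :=
  measurable_matrix_inv.comp_aemeasurable (aemeasurable_tailGram mX m n)

variable [IsProbabilityMeasure P]

/-- Law of large numbers for the Gram matrix of the covariates with index in `[s n, n)`. -/
lemma ae_tendsto_tailGram (hXindep : iIndepFun X P) (hXid : ∀ i, IdentDistrib (X i) (X 0) P P)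
    (hXmem : MemLp (X 0) 2 P) (hXmean : ∫ ω, X 0 ω ∂P = 0) (hs : ∀ n, s n ≤ n)
    (hso : (fun n => (s n : ℝ)) =o[atTop] fun n => (n : ℝ)) :
    ∀ᵐ ω ∂P, Tendsto (fun n : ℕ => (n : ℝ)⁻¹ • tailGram (fun i => X i ω) (s n) n) atTop
      (𝓝 (covarianceMatrix P (X 0))) := by
  have key : ∀ j k, ∀ᵐ ω ∂P, Tendsto (fun n : ℕ => (∑ i ∈ Finset.range n, X i ω j * X i ω k) / n)
      atTop (𝓝 (covarianceMatrix P (X 0) j k)) := fun j k => by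
    rw [← integral_coord_mul_coord hXmem hXmean]
    have hm : Measurable fun x : EuclideanSpace ℝ (Fin d) => x j * x k := by fun_prop
    exact strong_law_ae_real (fun i ω => X i ω j * X i ω k)
      ((memLp_coord hXmem j).integrable_mul (memLp_coord hXmem k))
      (fun i i' hii' => (hXindep.indepFun hii').comp hm hm) fun i => (hXid i).comp hm
  filter_upwards [ae_all_iff.2 fun j => ae_all_iff.2 fun k => key j k] with ω hω
  refine tendsto_pi_nhds.2 fun j => tendsto_pi_nhds.2 fun k => ?_
  refine (tendsto_sum_Ico_div (hω j k) hs hso).congr fun n => ?_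
  simp [tailGram, Matrix.sum_apply, Matrix.vecMulVec_apply, div_eq_inv_mul]

lemma ae_tendsto_smul_tailGram_inv (hXindep : iIndepFun X P)
    (hXid : ∀ i, IdentDistrib (X i) (X 0) P P)
    (hXmem : MemLp (X 0) 2 P) (hXmean : ∫ ω, X 0 ω ∂P = 0)
    (hXcov : (covarianceMatrix P (X 0)).PosDef) (hs : ∀ n, s n ≤ n)
    (hso : (fun n => (s n : ℝ)) =o[atTop] fun n => (n : ℝ)) :
    ∀ᵐ ω ∂P, (∀ᶠ n in atTop, IsUnit (tailGram (fun i => X i ω) (s n) n).det) ∧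
      Tendsto (fun n : ℕ => (n : ℝ) • (tailGram (fun i => X i ω) (s n) n)⁻¹) atTop
      (𝓝 (covarianceMatrix P (X 0))⁻¹) := by
  filter_upwards [ae_tendsto_tailGram hXindep hXid hXmem hXmean hs hso] with ω hω
  have hdet := hXcov.det_pos.ne'
  have h1 := ((continuous_id.matrix_det).tendsto (covarianceMatrix P (X 0))).comp hω
  have hunit : ∀ᶠ n in atTop, IsUnit (tailGram (fun i => X i ω) (s n) n).det := by
    filter_upwards [h1.eventually_ne hdet] with n hn
    rw [isUnit_iff_ne_zero]
    intro h
    simp only [Function.comp, id, Matrix.det_smul, h, mul_zero, ne_eq, not_true_eq_false] at hn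
  refine ⟨hunit, (tendsto_matrix_inv hω hdet).congr' ?_⟩
  filter_upwards [hunit, eventually_gt_atTop 0] with n hn hn0
  have hne : (n : ℝ) ≠ 0 := by positivity
  have := Matrix.inv_smul' (A := tailGram (fun i => X i ω) (s n) n) (Units.mk0 (n : ℝ) hne)⁻¹ hn
  simpa [Units.smul_def] using this

end LawOfLargeNumbers

/-! ### Convergence in probability, Gaussian images and Slutsky's theorem -/

section Probability

variable {Ω : Type*} [MeasurableSpace Ω] {P : Measure Ω} {d : ℕ}

lemma WithProbGoingToOne.and {E F : ℕ → Ω → Prop} (hE : WithProbGoingToOne P E)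
    (hF : WithProbGoingToOne P F) : WithProbGoingToOne P fun n ω => E n ω ∧ F n ω := by
  have h : Tendsto (fun n => P {ω | ¬ E n ω} + P {ω | ¬ F n ω}) atTop (𝓝 0) := by
    simpa using Tendsto.add hE hF
  refine tendsto_of_tendsto_of_tendsto_of_le_of_le tendsto_const_nhds h (fun _ => zero_le)
    fun n => (measure_mono fun ω hω => ?_).trans (measure_union_le _ _)
  exact not_and_or.1 hω

lemma WithProbGoingToOne.mono {E F : ℕ → Ω → Prop} (hE : WithProbGoingToOne P E)
    (h : ∀ᶠ n in atTop, ∀ ω, E n ω → F n ω) : WithProbGoingToOne P F :=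
  tendsto_of_tendsto_of_tendsto_of_le_of_le' tendsto_const_nhds hE
    (Eventually.of_forall fun _ => zero_le)
    (h.mono fun _ hn => measure_mono fun ω hω hEω => hω (hn ω hEω))

lemma tendstoInMeasure_of_withProbGoingToOne {E : Type*} [SeminormedAddCommGroup E]
    {R : ℕ → Ω → E} {r : ℕ → ℝ} (hr : Tendsto r atTop (𝓝 0))
    (h : WithProbGoingToOne P fun n ω => ‖R n ω‖ ≤ r n) :
    TendstoInMeasure P R atTop fun _ => 0 := by
  rw [tendstoInMeasure_iff_norm]
  intro δ hδ
  have := h.mono (F := fun n ω => ¬ δ ≤ ‖R n ω - 0‖) <| by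
    filter_upwards [hr.eventually_lt_const hδ] with _ hn ω hω
    rw [sub_zero, not_le]
    exact hω.trans_lt hn
  simpa [WithProbGoingToOne] using this

lemma withProbGoingToOne_of_tendstoInMeasure {E : Type*} [SeminormedAddCommGroup E]
    {R : ℕ → Ω → E} {g : Ω → E} (h : TendstoInMeasure P R atTop g) {δ : ℝ} (hδ : 0 < δ) :
    WithProbGoingToOne P fun n ω => ‖R n ω - g ω‖ < δ := by
  simpa [WithProbGoingToOne] using tendstoInMeasure_iff_norm.1 h δ hδ

variable [IsProbabilityMeasure P]

/-- The indicators tend to 1 almost surely, hence in measure; null-measurability of the events makes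
this passage legitimate. -/
lemma withProbGoingToOne_of_ae_eventually {E : ℕ → Ω → Prop}
    (h : ∀ᵐ ω ∂P, ∀ᶠ n in atTop, E n ω)
    (hE : ∀ n, NullMeasurableSet {ω | E n ω} P) : WithProbGoingToOne P E := by
  classical
  have hm : ∀ n, AEStronglyMeasurable ({ω | E n ω}.indicator fun _ => (1 : ℝ)) P := fun n =>
    (aestronglyMeasurable_const (b := (1 : ℝ))).indicator₀ (hE n)
  have := tendstoInMeasure_of_tendsto_ae (g := fun _ => (1 : ℝ)) hm (by
    filter_upwards [h] with ω hω
    exact tendsto_const_nhds.congr' (hω.mono fun n hn => by simp [hn]))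
  refine (withProbGoingToOne_of_tendstoInMeasure this zero_lt_one).mono
    (Eventually.of_forall fun n ω hω => ?_)
  by_contra hne
  simp [hne] at hω

/-- Moving `M` across the inner product evaluates the original characteristic function at the
transpose applied to `t`, which conjugates the quadratic form. -/
lemma multivariateGaussian_map_mulVec {S : Matrix (Fin d) (Fin d) ℝ} (hS : S.PosSemidef)
    (M : Matrix (Fin d) (Fin d) ℝ) :
    (multivariateGaussian 0 S).map (fun z => WithLp.toLp 2 (M.mulVec (WithLp.ofLp z))) =
      multivariateGaussian 0 (M * S * M.transpose) := by
  have hm : Measurable fun z : EuclideanSpace ℝ (Fin d) =>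
      WithLp.toLp 2 (M.mulVec (WithLp.ofLp z)) :=
    ((Matrix.toEuclideanCLM (𝕜 := ℝ) M).continuous).measurable
  have : IsProbabilityMeasure ((multivariateGaussian 0 S).map
      (fun z => WithLp.toLp 2 (M.mulVec (WithLp.ofLp z)))) :=
    Measure.isProbabilityMeasure_map hm.aemeasurable
  have hS' : (M * S * M.transpose).PosSemidef := by
    simpa using hS.mul_mul_conjTranspose_same M
  refine Measure.ext_of_charFun ?_
  ext t
  have h1 : charFun ((multivariateGaussian 0 S).map
      (fun z => WithLp.toLp 2 (M.mulVec (WithLp.ofLp z)))) t =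
      charFun (multivariateGaussian 0 S) (WithLp.toLp 2 (M.transpose.mulVec (WithLp.ofLp t))) := by
    rw [charFun_apply, charFun_apply, integral_map hm.aemeasurable (by fun_prop)]
    refine integral_congr_ae (Eventually.of_forall fun z => ?_)
    have : (inner ℝ (WithLp.toLp 2 (M.mulVec (WithLp.ofLp z))) t : ℝ) =
        inner ℝ z (WithLp.toLp 2 (M.transpose.mulVec (WithLp.ofLp t))) := by
      simp only [EuclideanSpace.inner_eq_star_dotProduct, star_trivial]
      rw [Matrix.dotProduct_mulVec, Matrix.mulVec_transpose, ← Matrix.dotProduct_mulVec]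
    simp only [this]
  rw [h1, charFun_multivariateGaussian hS, charFun_multivariateGaussian hS']
  congr 2
  · simp
  · simp only [← Matrix.mulVec_mulVec]
    rw [Matrix.dotProduct_mulVec (WithLp.ofLp t) M, ← Matrix.mulVec_transpose]

/-- Slutsky's theorem for a random matrix converging in probability, applied to a sequence with a
Gaussian limit in distribution, up to a negligible remainder. -/
lemma convergesToNormal_mulVec {T R : ℕ → Ω → EuclideanSpace ℝ (Fin d)}
    {M : ℕ → Ω → Fin d → Fin d → ℝ} {S C : Matrix (Fin d) (Fin d) ℝ} (hS : S.PosSemidef)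
    (hT : ConvergesToNormal P T S) (hR : TendstoInMeasure P R atTop fun _ => 0)
    (hRm : ∀ n, AEMeasurable (R n) P) (hM : TendstoInMeasure P M atTop fun _ => C)
    (hMm : ∀ n, AEMeasurable (M n) P) :
    ConvergesToNormal P
      (fun n ω => WithLp.toLp 2 ((Matrix.of (M n ω)).mulVec (WithLp.ofLp (T n ω + R n ω))))
      (C * S * C.transpose) := by
  have h1 := TendstoInDistribution.add_of_tendstoInMeasure_const hT hR hRm
  have hg : Continuous fun p : EuclideanSpace ℝ (Fin d) × (Fin d → Fin d → ℝ) =>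
      (WithLp.toLp 2 ((Matrix.of p.2).mulVec (WithLp.ofLp p.1)) : EuclideanSpace ℝ (Fin d)) := by
    refine (PiLp.continuous_toLp 2 _).comp ?_
    refine continuous_pi fun j => ?_
    simp only [Matrix.mulVec, dotProduct, Matrix.of_apply]
    fun_prop
  have h2 := h1.continuous_comp_prodMk_of_tendstoInMeasure_const hg hM hMm
  refine ⟨h2.forall_aemeasurable, aemeasurable_id, ?_⟩
  have h3 := h2.tendsto
  have hlim : (multivariateGaussian 0 S).map (fun ω : EuclideanSpace ℝ (Fin d) =>
      (WithLp.toLp 2 ((Matrix.of (C : Fin d → Fin d → ℝ)).mulVec (WithLp.ofLp (id ω + 0))))) =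
      (multivariateGaussian 0 (C * S * C.transpose)).map id := by
    rw [Measure.map_id, ← multivariateGaussian_map_mulVec hS]
    simp only [add_zero, id]
    rfl
  exact h3.mono_right (le_of_eq (congrArg 𝓝 (Subtype.ext hlim)))

end Probability

/-! ### The oracle estimate and its limit law -/

section Oracle

variable {Ω : Type*} [MeasurableSpace Ω] {P : Measure Ω} {d : ℕ}

/-- The score at the true parameter when the indices below `s` are clipped. -/
noncomputable def oracleScore (l : ℝ) (s n : ℕ) (m e : ℕ → ℝ)
    (x : ℕ → EuclideanSpace ℝ (Fin d)) : EuclideanSpace ℝ (Fin d) :=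
  ∑ i ∈ Finset.range s, (l * Real.sign (m i)) • x i + ∑ i ∈ Finset.Ico s n, (m i + e i) • x i

/-- The solution of the linear system to which the score equation reduces when exactly the indices
below `s` are clipped. -/
noncomputable def oracleEstimate (l : ℝ) (s n : ℕ) (m e : ℕ → ℝ)
    (x : ℕ → EuclideanSpace ℝ (Fin d)) (β : EuclideanSpace ℝ (Fin d)) :
    EuclideanSpace ℝ (Fin d) :=
  β + WithLp.toLp 2 ((tailGram x s n)⁻¹.mulVec (WithLp.ofLp (oracleScore l s n m e x)))

lemma aemeasurable_oracleEstimate {X : ℕ → Ω → EuclideanSpace ℝ (Fin d)} {ε : ℕ → Ω → ℝ}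
    (mX : ∀ i, AEMeasurable (X i) P) (mε : ∀ i, AEMeasurable (ε i) P) (l : ℝ) (s n : ℕ)
    (m : ℕ → ℝ) (β : EuclideanSpace ℝ (Fin d)) :
    AEMeasurable (fun ω => oracleEstimate l s n m (fun i => ε i ω) (fun i => X i ω) β) P := by
  have h1 : AEMeasurable (fun ω => oracleScore l s n m (fun i => ε i ω) (fun i => X i ω)) P := by
    unfold oracleScore
    fun_prop
  have h2 := aemeasurable_tailGram_inv mX s n
  refine aemeasurable_const.add ((PiLp.continuous_toLp 2 _).measurable.comp_aemeasurable ?_)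
  refine aemeasurable_pi_iff.2 fun j => ?_
  simp only [Matrix.mulVec, dotProduct]
  refine Finset.aemeasurable_fun_sum _ fun k _ => ?_
  exact ((measurable_pi_apply k).comp_aemeasurable
    ((measurable_pi_apply j).comp_aemeasurable h2)).mul (by fun_prop)

lemma smul_oracleEstimate_sub {s n : ℕ} (hs : s ≤ n) (l r : ℝ) (m e : ℕ → ℝ)
    (x : ℕ → EuclideanSpace ℝ (Fin d)) (β : EuclideanSpace ℝ (Fin d)) :
    r • (oracleEstimate l s n m e x β - β) =
      WithLp.toLp 2 ((Matrix.of fun j k => (n : ℝ) * (tailGram x s n)⁻¹ j k).mulVec (WithLp.ofLp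
        ((∑ i ∈ Finset.range s, (r * l / n * Real.sign (m i)) • x i +
          ∑ i ∈ Finset.Ico s n, (r / n * e i) • x i) +
          (r / n) • ∑ i ∈ Finset.Ico s n, m i • x i))) := by
  have h1 : (∑ i ∈ Finset.range s, (r * l / n * Real.sign (m i)) • x i +
          ∑ i ∈ Finset.Ico s n, (r / n * e i) • x i) +
          (r / n) • ∑ i ∈ Finset.Ico s n, m i • x i = (r / n) • oracleScore l s n m e x := by
    simp only [oracleScore, smul_add, Finset.smul_sum, smul_smul, add_smul, Finset.sum_add_distrib]
    rw [add_assoc, add_comm (∑ i ∈ Finset.Ico s n, (r / n * e i) • x i)]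
    congr 1
    exact Finset.sum_congr rfl fun i _ => by congr 1; ring
  have h2 : (Matrix.of fun j k => (n : ℝ) * (tailGram x s n)⁻¹ j k) =
      (n : ℝ) • (tailGram x s n)⁻¹ := rfl
  rw [h1, h2, oracleEstimate, add_sub_cancel_left, WithLp.ofLp_smul, Matrix.mulVec_smul,
    Matrix.smul_mulVec, smul_smul, WithLp.toLp_smul]
  -- For `n = 0` the quotient `r / n` is the default 0, but all sums are empty and both sides
  -- vanish.
  rcases Nat.eq_zero_or_pos n with rfl | hn
  · obtain rfl : s = 0 := by omega
    simp [oracleScore]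
  · rw [div_mul_cancel₀ _ (by positivity : (n : ℝ) ≠ 0)]

variable [IsProbabilityMeasure P]

/-- The normal law with zero covariance is the Dirac mass at 0, which gives no mass to the closed
set `δ ≤ ‖z‖`; the portmanteau theorem concludes. -/
lemma tendstoInMeasure_of_convergesToNormal_zero {Z : ℕ → Ω → EuclideanSpace ℝ (Fin d)}
    (h : ConvergesToNormal P Z 0) : TendstoInMeasure P Z atTop fun _ => 0 := by
  rw [tendstoInMeasure_iff_norm]
  intro δ hδ
  have hF : IsClosed {z : EuclideanSpace ℝ (Fin d) | δ ≤ ‖z‖} :=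
    isClosed_le continuous_const continuous_norm
  have h1 := ProbabilityMeasure.limsup_measure_closed_le_of_tendsto h.tendsto hF
  have h2 : multivariateGaussian 0 (0 : Matrix (Fin d) (Fin d) ℝ) = Measure.dirac 0 := by
    simp [multivariateGaussian]
  simp only [ProbabilityMeasure.coe_mk, Measure.map_id, h2, Measure.dirac_apply' _ hF.measurableSet]
    at h1
  have h3 : Set.indicator {z : EuclideanSpace ℝ (Fin d) | δ ≤ ‖z‖} (1 : EuclideanSpace ℝ (Fin d) → ENNReal) 0 = 0 := by
    simp [hδ]
  rw [h3] at h1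
  refine tendsto_of_le_liminf_of_limsup_le zero_le (le_of_eq_of_le ?_ h1)
  congr 1
  ext1 n
  rw [Measure.map_apply_of_aemeasurable (h.forall_aemeasurable n) hF.measurableSet]
  simp

/-- Limit in distribution of the rescaled error of the oracle estimate, for a general rate. -/
theorem convergesToNormal_oracleEstimate {X : ℕ → Ω → EuclideanSpace ℝ (Fin d)} {ε : ℕ → Ω → ℝ}
    {σ : ℝ} (β : EuclideanSpace ℝ (Fin d))
    (hXindep : iIndepFun X P) (hXid : ∀ i, IdentDistrib (X i) (X 0) P P)
    (hXmem : MemLp (X 0) 2 P) (hXmean : ∫ ω, X 0 ω ∂P = 0)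
    (hXcov : (covarianceMatrix P (X 0)).PosDef)
    (hεindep : iIndepFun ε P) (hεid : ∀ i, IdentDistrib (ε i) (ε 0) P P)
    (hεmem : MemLp (ε 0) 2 P) (hεmean : ∫ ω, ε 0 ω ∂P = 0) (hεvar : Var[ε 0; P] = σ ^ 2)
    (hXε : IndepFun (fun ω i => X i ω) (fun ω i => ε i ω) P)
    {κ γ : ℕ → ℝ} (hγpos : ∀ n, 0 < γ n)
    (hXκ : WithProbGoingToOne P fun n ω => ∀ i < n, ‖X i ω‖ ≤ κ n)
    {lam : ℕ → ℝ} {s₁ s₂ : ℕ → ℕ} {μ : ℕ → ℕ → ℝ} (hs : ∀ n, s₁ n + s₂ n ≤ n)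
    (hs₁ : (fun n => (s₁ n : ℝ)) =o[atTop] fun n => (n : ℝ))
    (hμbdd : ∀ n i, s₁ n ≤ i → i < s₁ n + s₂ n → μ n i ≠ 0 ∧ |μ n i| ≤ γ n)
    (hμzero : ∀ n i, s₁ n + s₂ n ≤ i → i < n → μ n i = 0)
    (hμlarge : ∀ᶠ n in atTop, ∀ i < s₁ n, μ n i ≠ 0)
    (hlamn : lam =o[atTop] fun n => √(n : ℝ))
    (hs₂' : (fun n => (s₂ n : ℝ)) =o[atTop] fun n => √(n : ℝ) / (κ n * γ n))
    {r : ℕ → ℝ} {A B : ℝ}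
    (hA : Tendsto (fun n => (s₁ n : ℝ) * (r n * lam n / n) ^ 2) atTop (𝓝 A))
    (hB : Tendsto (fun n => r n ^ 2 / n) atTop (𝓝 B)) :
    ConvergesToNormal P
      (fun n ω => r n • (oracleEstimate (lam n) (s₁ n) n (μ n) (fun i => ε i ω)
        (fun i => X i ω) β - β))
      ((A + B * σ ^ 2) • (covarianceMatrix P (X 0))⁻¹) := by
  have mX : ∀ i, AEMeasurable (X i) P := fun i => (hXid i).aemeasurable_fst
  have hs' : ∀ n, s₁ n ≤ n := fun n => (Nat.le_add_right _ _).trans (hs n)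
  have hA0 : 0 ≤ A := ge_of_tendsto' hA fun n => by positivity
  have hB0 : 0 ≤ B := ge_of_tendsto' hB fun n => by positivity
  -- The rate is at most of order `√n`; with `lam ≪ √n` this makes the individual weights of both
  -- blocks vanish.
  have hrn : Tendsto (fun n : ℕ => |r n| / √(n : ℝ)) atTop (𝓝 √B) := by
    refine ((Real.continuous_sqrt.tendsto B).comp hB).congr fun n => ?_
    simp only [Function.comp]
    rw [Real.sqrt_div (sq_nonneg _), Real.sqrt_sq_eq_abs]
  have hsqrt : Tendsto (fun n : ℕ => (√(n : ℝ))⁻¹) atTop (𝓝 0) :=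
    tendsto_inv_atTop_zero.comp (Real.tendsto_sqrt_atTop.comp tendsto_natCast_atTop_atTop)
  have hc : Tendsto (fun n : ℕ => r n / n) atTop (𝓝 0) := by
    rw [tendsto_zero_iff_abs_tendsto_zero]
    have := hrn.mul hsqrt
    rw [mul_zero] at this
    refine this.congr fun n => ?_
    simp only [Function.comp, abs_div, Nat.abs_cast]
    rw [← div_eq_mul_inv, div_div, Real.mul_self_sqrt (Nat.cast_nonneg n)]
  have ha : Tendsto (fun n : ℕ => r n * lam n / n) atTop (𝓝 0) := by
    rw [tendsto_zero_iff_abs_tendsto_zero]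
    have := hrn.mul hlamn.tendsto_div_nhds_zero.abs
    rw [abs_zero, mul_zero] at this
    refine this.congr fun n => ?_
    simp only [Function.comp, abs_div, Nat.abs_cast, abs_mul, abs_of_nonneg (Real.sqrt_nonneg _)]
    rw [div_mul_div_comm, Real.mul_self_sqrt (Nat.cast_nonneg n)]
  have hB' : Tendsto (fun n => ((n - s₁ n : ℕ) : ℝ) * (r n / n) ^ 2) atTop (𝓝 B) := by
    have h1 : Tendsto (fun n : ℕ => (1 - (s₁ n : ℝ) / n) * (r n ^ 2 / n)) atTop (𝓝 B) := by
      simpa using (hs₁.tendsto_div_nhds_zero.const_sub 1).mul hB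
    refine h1.congr' ?_
    filter_upwards [eventually_gt_atTop 0] with n hn
    rw [Nat.cast_sub (hs' n)]
    field_simp
  have hT := tendstoInDistribution_two_blocks hXindep hXid hXmem hXmean hXcov.posSemidef hεindep
    hεid hεmem hεmean hεvar hXε hs' (w := fun n i => r n * lam n / n * Real.sign (μ n i)) ha hc
    (by
      filter_upwards [hμlarge] with n hn i hi
      rw [abs_mul]
      rcases Real.sign_apply_eq_of_ne_zero _ (hn i hi) with h | h <;> simp [h]) hA hB'
  -- A worst-case bound on the bias: `s₂` terms of norm at most `γ * κ`, rescaled by `r / n`. It is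
  -- a bounded factor times `s₂ κ γ / √n`.
  have hbound : Tendsto (fun n : ℕ => |r n| / n * (s₂ n * (γ n * κ n))) atTop (𝓝 0) := by
    have h1 := hrn.mul hs₂'.tendsto_div_nhds_zero
    rw [mul_zero] at h1
    refine h1.congr fun n => ?_
    rw [div_div_eq_mul_div, div_mul_div_comm, Real.mul_self_sqrt (Nat.cast_nonneg n)]
    ring
  have hR := tendstoInMeasure_of_withProbGoingToOne (P := P)
    (R := fun n ω => (r n / n) • ∑ i ∈ Finset.Ico (s₁ n) n, μ n i • X i ω) hbound
    (hXκ.mono (Eventually.of_forall fun n ω hω => by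
      rw [norm_smul, Real.norm_eq_abs, abs_div, Nat.abs_cast]
      refine mul_le_mul_of_nonneg_left ?_ (by positivity)
      rw [← Finset.sum_Ico_consecutive _ (Nat.le_add_right (s₁ n) (s₂ n)) (hs n),
        Finset.sum_eq_zero (s := Finset.Ico (s₁ n + s₂ n) n) fun i hi => by
          rw [hμzero n i (Finset.mem_Ico.1 hi).1 (Finset.mem_Ico.1 hi).2, zero_smul], add_zero]
      refine (norm_sum_le_of_le _ fun i hi => ?_).trans (b := ∑ i ∈ Finset.Ico (s₁ n)
        (s₁ n + s₂ n), γ n * κ n) (le_of_eq (by simp))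
      have hi' := Finset.mem_Ico.1 hi
      rw [norm_smul]
      exact mul_le_mul (hμbdd n i hi'.1 hi'.2).2 (hω i (hi'.2.trans_le (hs n))) (norm_nonneg _)
        (hγpos n).le))
  have hMm : ∀ n : ℕ, AEMeasurable
      (fun ω (j k : Fin d) => (n : ℝ) * (tailGram (fun i => X i ω) (s₁ n) n)⁻¹ j k) P := fun n =>
    (aemeasurable_tailGram_inv mX (s₁ n) n).const_smul (n : ℝ)
  set C : Matrix (Fin d) (Fin d) ℝ := (covarianceMatrix P (X 0))⁻¹ with hC
  have hM : TendstoInMeasure P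
      (fun (n : ℕ) ω (j k : Fin d) => (n : ℝ) * (tailGram (fun i => X i ω) (s₁ n) n)⁻¹ j k) atTop
      fun _ => C := by
    refine tendstoInMeasure_of_tendsto_ae (fun n => (hMm n).aestronglyMeasurable) ?_
    filter_upwards [ae_tendsto_smul_tailGram_inv hXindep hXid hXmem hXmean hXcov hs' hs₁]
      with ω hω using hω.2
  have hS : ((A + B * σ ^ 2) • covarianceMatrix P (X 0)).PosSemidef :=
    hXcov.posSemidef.smul (by positivity)
  have hfin := convergesToNormal_mulVec (C := C) hS hT hR (fun n => by fun_prop) hM hMm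
  have hunit : IsUnit (covarianceMatrix P (X 0)).det := isUnit_iff_ne_zero.2 hXcov.det_pos.ne'
  have hsymm : C.transpose = C := by
    simpa using hXcov.inv.isHermitian.eq
  rw [hsymm, Matrix.mul_smul, hC, Matrix.nonsing_inv_mul _ hunit, Matrix.smul_mul, one_mul] at hfin
  simpa only [smul_oracleEstimate_sub (hs' _)] using hfin

end Oracle

/-! ### Assembly: uniqueness, consistency and the three regimes -/

theorem theorem3p4
    {Ω : Type*} [MeasurableSpace Ω] (P : Measure Ω) [IsProbabilityMeasure P]
    -- fixed dimension, true structural parameter, covariates and errors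
    (d : ℕ) (β : EuclideanSpace ℝ (Fin d))
    (X : ℕ → Ω → EuclideanSpace ℝ (Fin d)) (ε : ℕ → Ω → ℝ) (σ : ℝ)
    (hXindep : iIndepFun X P) (hXid : ∀ i, IdentDistrib (X i) (X 0) P P)
    (hXmem : MemLp (X 0) 2 P) (hXmean : ∫ ω, X 0 ω ∂P = 0)
    (hXcov : (covarianceMatrix P (X 0)).PosDef)
    (hεindep : iIndepFun ε P) (hεid : ∀ i, IdentDistrib (ε i) (ε 0) P P)
    (hεmem : MemLp (ε 0) 2 P) (hεmean : ∫ ω, ε 0 ω ∂P = 0) (hεvar : Var[ε 0; P] = σ ^ 2)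
    (hXε : IndepFun (fun ω i => X i ω) (fun ω i => ε i ω) P)
    -- the bounding sequences of the covariates and the errors
    (κ γ : ℕ → ℝ) (hκpos : ∀ n, 0 < κ n) (hγpos : ∀ n, 0 < γ n)
    (hκn : κ =o[atTop] fun n => √(n : ℝ)) (hγn : γ =o[atTop] fun n => √(n : ℝ))
    (hXκ : WithProbGoingToOne P fun n ω => ∀ i < n, ‖X i ω‖ ≤ κ n)
    (hεγ : WithProbGoingToOne P fun n ω => ∀ i < n, |ε i ω| ≤ γ n)
    -- the regularization parameter, and the sparse incidental parameters (indices from 0):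
    -- `s₁ n` large ones, then `s₂ n` nonzero bounded ones, then zeros
    (lam : ℕ → ℝ) (s₁ s₂ : ℕ → ℕ) (μ : ℕ → ℕ → ℝ)
    (hs : ∀ n, s₁ n + s₂ n ≤ n)
    (hs₁ : (fun n => (s₁ n : ℝ)) =o[atTop] fun n => (n : ℝ))
    (hs₂ : (fun n => (s₂ n : ℝ)) =o[atTop] fun n => (n : ℝ))
    (hμbdd : ∀ n i, s₁ n ≤ i → i < s₁ n + s₂ n → μ n i ≠ 0 ∧ |μ n i| ≤ γ n)
    (hμzero : ∀ n i, s₁ n + s₂ n ≤ i → i < n → μ n i = 0)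
    (hlamκ : κ =o[atTop] lam)
    (hlamγ : ∃ α : ℝ, 2 < α ∧ ∀ n, α * γ n ≤ lam n)
    -- `lam n` is of smaller order than the minimum of `|μ n i|` over `i < s₁ n`
    (hlamμ : ∀ c : ℝ, 0 < c → ∀ᶠ n in atTop, ∀ i < s₁ n, lam n ≤ c * |μ n i|)
    (hlamn : lam =o[atTop] fun n => √(n : ℝ))
    -- the condition on the number of bounded incidental parameters
    (hs₂' : (fun n => (s₂ n : ℝ)) =o[atTop] fun n => √(n : ℝ) / (κ n * γ n)) :
    ∃ βhat : ℕ → Ω → EuclideanSpace ℝ (Fin d),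
      (∀ n, AEMeasurable (βhat n) P) ∧
      -- with probability going to one, `βhat n` is the unique penalized estimate and the
      -- unique root of the estimating function
      (WithProbGoingToOne P fun n ω => ∀ b,
        IsPenalizedEstimate (lam n) (sampleX X n ω) (sampleY X ε μ β n ω) b ↔ b = βhat n ω) ∧
      (WithProbGoingToOne P fun n ω => ∀ b,
        estimatingFunction (lam n) (sampleX X n ω) (sampleY X ε μ β n ω) b = 0 ↔
          b = βhat n ω) ∧
      -- consistency
      TendstoInMeasure P βhat atTop (fun _ => β) ∧
      -- the three regimes
      ((fun n => (s₁ n : ℝ)) =o[atTop] (fun n : ℕ => (n : ℝ) / lam n ^ 2) →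
        ConvergesToNormal P (fun n ω => √(n : ℝ) • (βhat n ω - β))
          (σ ^ 2 • (covarianceMatrix P (X 0))⁻¹)) ∧
      (∀ b : ℝ, 0 < b →
        (fun n => (s₁ n : ℝ)) ~[atTop] (fun n : ℕ => b * (n : ℝ) / lam n ^ 2) →
        ConvergesToNormal P (fun n ω => √(n : ℝ) • (βhat n ω - β))
          ((b + σ ^ 2) • (covarianceMatrix P (X 0))⁻¹)) ∧
      ((fun n : ℕ => (n : ℝ) / lam n ^ 2) =o[atTop] (fun n => (s₁ n : ℝ)) →
        ConvergesToNormal P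
          (fun n ω => ((n : ℝ) / (lam n * √(s₁ n : ℝ))) • (βhat n ω - β))
          ((covarianceMatrix P (X 0))⁻¹)) := by
  obtain ⟨α, hα, hlamα⟩ := hlamγ
  have hα0 : 0 < α := by linarith
  have hlam : ∀ n, 0 < lam n := fun n => (mul_pos hα0 (hγpos n)).trans_le (hlamα n)
  have hs' : ∀ n, s₁ n ≤ n := fun n => (Nat.le_add_right _ _).trans (hs n)
  have mX : ∀ i, AEMeasurable (X i) P := fun i => (hXid i).aemeasurable_fst
  have mε : ∀ i, AEMeasurable (ε i) P := fun i => (hεid i).aemeasurable_fst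
  have hμlarge : ∀ᶠ n in atTop, ∀ i < s₁ n, 4 * lam n ≤ |μ n i| := by
    filter_upwards [hlamμ (1 / 4) (by norm_num)] with n hn i hi
    linarith [hn i hi]
  have hμne : ∀ᶠ n in atTop, ∀ i < s₁ n, μ n i ≠ 0 := by
    filter_upwards [hμlarge] with n hn i hi h
    have := hn i hi
    rw [h, abs_zero] at this
    linarith [hlam n]
  -- As `α > 2`, `2 * γ n` uses only the fraction `2 / α` of `lam n`; `κ ≪ lam` lets `κ n` fit in
  -- half of what remains.
  have hthr : ∀ᶠ n in atTop, 2 * γ n + κ n < lam n := by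
    have hc : 0 < (1 - 2 / α) / 2 := by
      have : 2 / α < 1 := (div_lt_one hα0).2 hα
      linarith
    filter_upwards [hlamκ.def hc] with n hn
    rw [Real.norm_of_nonneg (hκpos n).le, Real.norm_of_nonneg (hlam n).le] at hn
    have h1 : 2 * γ n ≤ 2 / α * lam n := by
      rw [div_mul_eq_mul_div, le_div_iff₀ hα0]
      linarith [hlamα n]
    have h2 : 0 < (1 - 2 / α) / 2 * lam n := mul_pos hc (hlam n)
    linarith
  set βhat : ℕ → Ω → EuclideanSpace ℝ (Fin d) := fun n ω =>
    oracleEstimate (lam n) (s₁ n) n (μ n) (fun i => ε i ω) (fun i => X i ω) β with hβhat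
  have hclt : ∀ {r : ℕ → ℝ} {A B : ℝ},
      Tendsto (fun n => (s₁ n : ℝ) * (r n * lam n / n) ^ 2) atTop (𝓝 A) →
      Tendsto (fun n => r n ^ 2 / n) atTop (𝓝 B) →
      ConvergesToNormal P (fun n ω => r n • (βhat n ω - β))
        ((A + B * σ ^ 2) • (covarianceMatrix P (X 0))⁻¹) := fun hA hB =>
    convergesToNormal_oracleEstimate β hXindep hXid hXmem hXmean hXcov hεindep hεid hεmem hεmean
      hεvar hXε hγpos hXκ hs hs₁ hμbdd hμzero hμne hlamn hs₂' hA hB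
  -- Consistency is the rate `r = 1`, for which `A = B = 0` and the limit law is degenerate.
  have hcons : TendstoInMeasure P βhat atTop (fun _ => β) := by
    have hA : Tendsto (fun n => (s₁ n : ℝ) * (1 * lam n / n) ^ 2) atTop (𝓝 0) := by
      have := hs₁.tendsto_div_nhds_zero.mul (hlamn.tendsto_div_nhds_zero.pow 2)
      rw [zero_mul] at this
      refine this.congr fun n => ?_
      rw [div_pow, Real.sq_sqrt (Nat.cast_nonneg n)]
      ring
    have hB : Tendsto (fun n : ℕ => (1 : ℝ) ^ 2 / n) atTop (𝓝 0) := by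
      simpa using tendsto_inv_atTop_nhds_zero_nat (𝕜 := ℝ)
    have h := hclt (r := fun _ => 1) hA hB
    simp only [one_smul, zero_mul, add_zero, zero_smul] at h
    have h2 := tendstoInMeasure_of_convergesToNormal_zero h
    rw [tendstoInMeasure_iff_norm] at h2 ⊢
    simpa only [sub_zero] using h2
  have hdet : WithProbGoingToOne P fun n ω =>
      IsUnit (tailGram (fun i => X i ω) (s₁ n) n).det := by
    refine withProbGoingToOne_of_ae_eventually ?_ fun n => ?_
    · filter_upwards [ae_tendsto_smul_tailGram_inv hXindep hXid hXmem hXmean hXcov hs' hs₁]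
        with ω hω using hω.1
    · have hm : Measurable fun A : Fin d → Fin d → ℝ => (Matrix.of A).det :=
        (continuous_id : Continuous fun A : Fin d → Fin d → ℝ => Matrix.of A).matrix_det.measurable
      have := (hm.comp_aemeasurable (aemeasurable_tailGram mX (s₁ n) n)).nullMeasurableSet_preimage
        (measurableSet_singleton (0 : ℝ)).compl
      convert this using 1
      ext ω
      simp only [isUnit_iff_ne_zero]
      rfl
  -- Consistency with radius 1 supplies the localization `‖βhat n ω - β‖ ≤ 1` under which the linear
  -- system is valid.
  have hgood := (((hXκ.and hεγ).and hdet).and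
    (withProbGoingToOne_of_tendstoInMeasure hcons one_pos)).mono
    (F := fun n ω => (∀ b, IsPenalizedEstimate (lam n) (sampleX X n ω) (sampleY X ε μ β n ω) b ↔
        b = βhat n ω) ∧
      ∀ b, estimatingFunction (lam n) (sampleX X n ω) (sampleY X ε μ β n ω) b = 0 ↔
        b = βhat n ω) <| by
    filter_upwards [hμlarge, hthr] with n hn1 hn2 ω ⟨⟨⟨h1, h2⟩, h3⟩, h4⟩
    refine unique_of_linear_system (x := fun i => X i ω) (e := fun i => ε i ω) (hs' n) (hlam n)
      hn2 h1 h2 hn1 (fun i hi1 hi2 => ?_) h4.le h3 ?_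
    · rcases lt_or_ge i (s₁ n + s₂ n) with h | h
      · exact (hμbdd n i hi1 h).2
      · rw [hμzero n i h hi2, abs_zero]
        exact (hγpos n).le
    · rw [hβhat]
      simp only [oracleEstimate, add_sub_cancel_left, Matrix.mulVec_mulVec,
        Matrix.mul_nonsing_inv _ h3, Matrix.one_mulVec]
      rfl
  have hsqrtB : Tendsto (fun n : ℕ => √(n : ℝ) ^ 2 / n) atTop (𝓝 1) := by
    refine tendsto_const_nhds.congr' ?_
    filter_upwards [eventually_gt_atTop 0] with n hn
    rw [Real.sq_sqrt (Nat.cast_nonneg n), div_self (by positivity)]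
  have hsqrtA : ∀ n : ℕ, (s₁ n : ℝ) * (√(n : ℝ) * lam n / n) ^ 2 =
      s₁ n / (n / lam n ^ 2) := fun n => by
    rcases Nat.eq_zero_or_pos n with rfl | hn
    · simp
    · have := (hlam n).ne'
      rw [div_pow, mul_pow, Real.sq_sqrt (Nat.cast_nonneg n)]
      field_simp
  refine ⟨βhat, fun n => aemeasurable_oracleEstimate mX mε _ _ _ _ _,
    hgood.mono (Eventually.of_forall fun n ω h => h.1),
    hgood.mono (Eventually.of_forall fun n ω h => h.2), hcons, fun h => ?_, fun b hb h => ?_,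
    fun h => ?_⟩
  -- Here `r = √n`, with `A = 0` and `B = 1`.
  · have hA := h.tendsto_div_nhds_zero
    simp only [← hsqrtA] at hA
    simpa using hclt hA hsqrtB
  -- Again `r = √n` and `B = 1`, but now `A = b`: the clipped block is of the same order as the
  -- noise.
  · have hne : ∀ᶠ n : ℕ in atTop, b * (n : ℝ) / lam n ^ 2 ≠ 0 := by
      filter_upwards [eventually_gt_atTop 0] with n hn
      have := hlam n
      positivity
    have h1 := ((isEquivalent_iff_tendsto_one hne).1 h).const_mul b
    rw [mul_one] at h1
    have hA : Tendsto (fun n => (s₁ n : ℝ) * (√(n : ℝ) * lam n / n) ^ 2) atTop (𝓝 b) := by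
      refine h1.congr fun n => ?_
      rw [hsqrtA, Pi.div_apply, mul_div_assoc, ← div_div, mul_div_assoc', mul_div_cancel₀ _ hb.ne']
    simpa using hclt hA hsqrtB
  · have h0 := h.tendsto_div_nhds_zero
    -- `s₁ n` dominates a positive sequence, so the rate is eventually free of division by zero. It
    -- gives `A = 1` exactly, and `B = 0` because `r² / n = (n / lam²) / s₁`.
    have hpos : ∀ᶠ n in atTop, 0 < s₁ n := by
      filter_upwards [h.def one_half_pos, eventually_gt_atTop 0] with n hn hn0
      by_contra hs0
      have hz : s₁ n = 0 := by omega
      have := hlam n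
      have hpos : 0 < (n : ℝ) / lam n ^ 2 := by positivity
      rw [hz, Nat.cast_zero, norm_zero, mul_zero] at hn
      exact absurd (norm_le_zero_iff.1 hn) hpos.ne'
    have hA : Tendsto (fun n => (s₁ n : ℝ) * ((n : ℝ) / (lam n * √(s₁ n : ℝ)) * lam n / n) ^ 2)
        atTop (𝓝 1) := by
      refine tendsto_const_nhds.congr' ?_
      filter_upwards [hpos, eventually_gt_atTop 0] with n hn hn0
      have := (hlam n).ne'
      have hs0 : √(s₁ n : ℝ) ^ 2 = s₁ n := Real.sq_sqrt (Nat.cast_nonneg _)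
      have hs1 : √(s₁ n : ℝ) ≠ 0 := by positivity
      have : (n : ℝ) / (lam n * √(s₁ n : ℝ)) * lam n / n = 1 / √(s₁ n : ℝ) := by field_simp
      rw [this, div_pow, hs0]
      field_simp
    have hB : Tendsto (fun n : ℕ => ((n : ℝ) / (lam n * √(s₁ n : ℝ))) ^ 2 / n) atTop (𝓝 0) := by
      refine h0.congr' ?_
      filter_upwards [hpos, eventually_gt_atTop 0] with n hn hn0
      have := (hlam n).ne'
      rw [div_pow, mul_pow, Real.sq_sqrt (Nat.cast_nonneg _)]
      field_simp
    simpa using hclt hA hB
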